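/- **Theorem 3.4.** Let $d\in\{2,3\}$, $T>0$, let $\Omega\subset\mathbb R^d$ be a polyhedral domain with $\partial\Omega=\partial_1\Omega\cup\partial_2\Omega$ (disjoint), and let $\mathcal T^h$ be a conforming partitioning of $\Omega$ into disjoint open simplices. Write $(\cdot,\cdot)$ for the $L^2(\Omega)$ inner product. *Physical data.* $\rho_\pm,\mu_\pm>0$; $\mathcal D_\Gamma\ge0$; $\mu_\Gamma,\lambda_\Gamma\in C(\mathbb R)$ with $\mu_\Gamma\ge0$ and $\lambda_\Gamma+\frac{2}{d-1}\mu_\Gamma\ge0$; $\psi_\infty\in(0,\infty]$; $\gamma\in C^1([0,\psi_\infty))$ with $\gamma'\le0$; and $F$ satisfies $\gamma(r)=F(r)-rF'(r)$ on $(0,\psi_\infty)$ and $\lim_{r\to0}rF'(r)=F(0)-\gamma(0)=0$. The forces satisfy $\vec f_1,\vec f_2\in L^2(0,T;[C(\overline\Omega)]^d)$, and $\vec f_i^h=\vec I_2^h\vec f_i$, where $\vec I^h_2$ is continuous piecewise quadratic Lagrange interpolation on $\mathcal T^h$. *Bulk spaces.* $\mathbb U^h$ is a space of continuous piecewise polynomial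 (of bounded degree) vector fields on $\mathcal T^h$ with $\vec\varphi=\vec 0$ on $\partial_1\Omega$ and $\vec\varphi\cdot\vec{\rm n}=0$ on $\partial_2\Omega$ ($\vec{\rm n}$ the outer unit normal). For each $t$, $\mathbb P^h(t)\subset L^2(\Omega)$ is a subspace and $\widehat{\mathbb P}^h(t)$ consists of its members of mean zero. $\underline{\underline D}(\vec u)$ denotes the symmetric part of $\nabla\vec u$. *Surfaces.* For $t\in[0,T]$ let $\Gamma^h(t)\subset\Omega$ be a closed polyhedral hypersurface, the union of the closures of disjoint nondegenerate $(d-1)$-simplices $\sigma^h_j(t)$ without hanging vertices, with fixed connectivity and with vertices $\vec q^h_k(t)$ that are differentiable in $t$. It separates $\Omega$ into an interior $\Omega^h_-(t)$ and an exterior $\Omega^h_+(t)$. The functions $\rho^h(t),\mu^h(t)$ are constant on each element $o\in\mathcal T^h$, with value $\rho_\pm,\mu_\pm$ if $o\subset\Omega_\pm^h(t)$ and $\frac12(\rho_-+\rho_+)$, $\frac12(\mu_-+\mu_+)$ otherwise. $W(\Gamma^h(t))$ is the space of continuous piecewise linear functions, with nodal basis $\chi^h_k$ and nodal interpolation $\pi^h$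 (componentwise $\vec\pi^h$). $\vec{\mathcal V}^h\in[W(\Gamma^h(t))]^d$ has vertex values $\frac{\rm d}{{\rm d}t}\vec q^h_k(t)$, and $\partial_t^{\circ,h}\zeta$ is the time derivative following the vertices, $\partial_t^{\circ,h}\sum_k\zeta_k\chi^h_k=\sum_k\zeta_k'\chi_k^h$. $W(\mathcal G^h_T)$ is the space of functions $\zeta(\cdot,t)\in W(\Gamma^h(t))$ with vertex values continuous on $[0,T]$, and $W_T(\mathcal G^h_T)$ the subspace where these are $C^1$ on $[0,T]$. $\langle\cdot,\cdot\rangle_{\Gamma^h(t)}$ is the $L^2(\Gamma^h(t))$ inner product and $$\langle\eta,\zeta\rangle^h_{\Gamma^h(t)}=\tfrac1d\sum_j\mathcal H^{d-1}(\sigma^h_j)\sum_{k=1}^d(\eta\zeta)\big((\vec q^h_{j_k})^-\big)$$ its mass-lumped version, where $\vec q^h_{j_1},\dots,\vec q^h_{j_d}$ are the vertices of $\sigma_j^h$ and ${}^-$ means the limit from within $\sigma_j^h$. With $\vec\nu^h$ the unit normal, $\underline{\underline{\mathcal P}}=\underline{\underline{\rm Id}}-\vec\nu^h\otimes\vec\nu^h$,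 $\nabla_s=\underline{\underline{\mathcal P}}\nabla$, $\underline{\underline D}_s^h(\vec\eta)=\frac12\underline{\underline{\mathcal P}}(\nabla_s\vec\eta+(\nabla_s\vec\eta)^T)\underline{\underline{\mathcal P}}$ and $\underline{\underline{\widehat D}}_s^h(\vec\eta)=\underline{\underline D}_s^h(\vec\eta)-\frac1{d-1}(\nabla_s\cdot\vec\eta)\underline{\underline{\mathcal P}}$. *Scheme.* Let $\Gamma^h$ be as above and let $\rho_\Gamma^h,\Psi^h\in W_T(\mathcal G^h_T)$, $\vec\kappa^h\in[W(\mathcal G_T^h)]^d$, $\vec U^h\in H^1(0,T;\mathbb U^h)$ with $\vec\pi^h[\vec U^h|_{\Gamma^h}]\in[W_T(\mathcal G^h_T)]^d$, and $P^h\in L^2(0,T;L^2(\Omega))$ with $P^h(t)\in\widehat{\mathbb P}^h(t)$ for a.e. $t$, be such that, for almost every $t\in(0,T)$ (for (a), (b), (f) the null set may depend on the test function; the derivatives $\frac{\rm d}{{\rm d}t}$ are required to exist there): (a) $\frac{\rm d}{{\rm d}t}\langle\rho_\Gamma^h,\zeta\rangle^h_{\Gamma^h(t)}=\langle\rho^h_\Gamma,\partial_t^{\circ,h}\zeta\rangle^h_{\Gamma^h(t)}$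 for all $\zeta\in W_T(\mathcal G^h_T)$; (b) for all $\vec\xi\in H^1(0,T;\mathbb U^h)$, $$\begin{aligned}&\tfrac12\Big[\tfrac{\rm d}{{\rm d}t}(\rho^h\vec U^h,\vec\xi)+(\rho^h\vec U^h_t,\vec\xi)-(\rho^h\vec U^h,\vec\xi_t)\Big]+2(\mu^h\underline{\underline D}(\vec U^h),\underline{\underline D}(\vec\xi))-(P^h,\nabla\cdot\vec\xi)\\&+\tfrac12\big(\rho^h,[(\vec I^h_2\vec U^h\cdot\nabla)\vec U^h]\cdot\vec\xi-[(\vec I_2^h\vec U^h\cdot\nabla)\vec\xi]\cdot\vec U^h\big)+\tfrac{\rm d}{{\rm d}t}\langle\rho^h_\Gamma\vec U^h,\vec\xi\rangle^h_{\Gamma^h(t)}\\&+2\langle\mu_\Gamma(\Psi^h)\underline{\underline D}^h_s(\vec\pi^h\vec U^h),\underline{\underline D}^h_s(\vec\pi^h\vec\xi)\rangle^h_{\Gamma^h(t)}+\langle\lambda_\Gamma(\Psi^h)\nabla_s\cdot(\vec\pi^h\vec U^h),\nabla_s\cdot(\vec\pi^h\vec\xi)\rangle^h_{\Gamma^h(t)}\\&-\langle\gamma(\Psi^h)\vec\kappa^h+\nabla_s[\pi^h\gamma(\Psi^h)],\vec\xi\rangle^h_{\Gamma^h(t)}=(\rho^h\vec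 f_1^h+\vec f_2^h,\vec\xi)+\langle\rho_\Gamma^h\vec U^h,\partial_t^{\circ,h}(\vec\pi^h\vec\xi)\rangle^h_{\Gamma^h(t)};\end{aligned}$$ (c) $(\nabla\cdot\vec U^h,\varphi)=0$ for all $\varphi\in\widehat{\mathbb P}^h(t)$; (d) $\langle\vec{\mathcal V}^h,\vec\chi\rangle^h_{\Gamma^h(t)}=\langle\vec U^h,\vec\chi\rangle^h_{\Gamma^h(t)}$ for all $\vec\chi\in[W(\Gamma^h(t))]^d$; (e) $\langle\vec\kappa^h,\vec\eta\rangle^h_{\Gamma^h(t)}+\langle\nabla_s\vec{\rm id},\nabla_s\vec\eta\rangle_{\Gamma^h(t)}=0$ for all $\vec\eta\in[W(\Gamma^h(t))]^d$; (f) $\frac{\rm d}{{\rm d}t}\langle\Psi^h,\chi\rangle^h_{\Gamma^h(t)}+\mathcal D_\Gamma\langle\nabla_s\Psi^h,\nabla_s\chi\rangle_{\Gamma^h(t)}=\langle\Psi^h,\partial_t^{\circ,h}\chi\rangle^h_{\Gamma^h(t)}$ for all $\chi\in W_T(\mathcal G^h_T)$. *Conclusions.* 1. $\frac{\rm d}{{\rm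 d}t}\langle\Psi^h,1\rangle_{\Gamma^h(t)}=0$ for every $t\in[0,T]$ (one-sided at the end points). 2. If $\mathcal D_\Gamma=0$, or if both $\int_{\sigma_j^h(t)}\nabla_s\chi_i^h\cdot\nabla_s\chi^h_k\,{\rm d}\mathcal H^{d-1}\le0$ for all $i\ne k$, all $j$ and all $t\in[0,T]$, and $\max_{0\le t\le T}\|\nabla_s\cdot\vec{\mathcal V}^h\|_{L^\infty(\Gamma^h(t))}<\infty$, then $\Psi^h(\cdot,0)\ge0$ implies $\Psi^h(\cdot,t)\ge0$ for all $t\in(0,T]$. 3. If $d=2$ and $0\le\Psi^h(\cdot,t)<\psi_\infty$ on $\Gamma^h(t)$ for all $t\in[0,T]$, then for almost every $t\in(0,T)$ the energy below is differentiable at $t$ and $$\begin{aligned}&\tfrac{\rm d}{{\rm d}t}\Big(\tfrac12\|[\rho^h]^{\frac12}\vec U^h\|_0^2+\tfrac12\langle\rho^h_\Gamma\vec U^h,\vec U^h\rangle^h_{\Gamma^h(t)}+\langle F(\Psi^h),1\rangle^h_{\Gamma^h(t)}\Big)+2\|[\mu^h]^{\frac12}\underline{\underline D}(\vec U^h)\|_0^2\\&+2\langle\mu_\Gamma(\Psi^h)\underline{\underline{\widehat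 D}}^h_s(\vec\pi^h\vec U^h),\underline{\underline{\widehat D}}^h_s(\vec\pi^h\vec U^h)\rangle^h_{\Gamma^h(t)}\\&+\langle(\lambda_\Gamma(\Psi^h)+\tfrac2{d-1}\mu_\Gamma(\Psi^h))\nabla_s\cdot(\vec\pi^h\vec U^h),\nabla_s\cdot(\vec\pi^h\vec U^h)\rangle^h_{\Gamma^h(t)}\le(\rho^h\vec f_1^h+\vec f_2^h,\vec U^h).\end{aligned}$$ -/

import Mathlib

open MeasureTheory Set Filter Topology

noncomputable section

namespace TwoPhase

/-- The ambient Euclidean space of dimension `d = n + 1`. Surface elements have dimension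
`n = d - 1` and `n + 1 = d` vertices; bulk elements have `n + 2 = d + 1` vertices. -/
abbrev E (n : ℕ) : Type := EuclideanSpace ℝ (Fin (n + 1))

/-- `C(closure Ω)` with values in the ambient space and the sup norm (for bounded `Ω` every
continuous function on the closure is bounded). -/
abbrev CBar {n : ℕ} (Ω : Set (E n)) : Type := BoundedContinuousFunction (closure Ω) (E n)

open Classical in
/-- The values of a function on `closure Ω`; the value off `closure Ω` is a dummy. -/
def ext {n : ℕ} {Ω : Set (E n)} (φ : CBar Ω) (x : E n) : E n :=
  if h : x ∈ closure Ω then φ ⟨x, h⟩ else 0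

/-- Frobenius product `A : B`. -/
def frob {n : ℕ} (A B : Matrix (Fin (n + 1)) (Fin (n + 1)) ℝ) : ℝ := ∑ i, ∑ j, A i j * B i j

/-! ### Bulk: differential operators, triangulation, velocity space -/

/-- `(∇ φ) i j = ∂ φ_i / ∂ x_j`. -/
def bulkGrad {n : ℕ} (φ : E n → E n) (x : E n) : Matrix (Fin (n + 1)) (Fin (n + 1)) ℝ :=
  Matrix.of fun i j => (fderiv ℝ φ x (EuclideanSpace.single j 1)) i

def bulkDiv {n : ℕ} (φ : E n → E n) (x : E n) : ℝ := (bulkGrad φ x).trace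

/-- Rate-of-deformation tensor `D(φ) = (∇ φ + (∇ φ)ᵀ) / 2`. -/
def bulkSym {n : ℕ} (φ : E n → E n) (x : E n) : Matrix (Fin (n + 1)) (Fin (n + 1)) ℝ :=
  (1 / 2 : ℝ) • (bulkGrad φ x + (bulkGrad φ x).transpose)

/-- A nondegenerate bulk simplex, given by its `d + 1` affinely independent vertices. -/
abbrev BulkSimplex (n : ℕ) : Type := AffineBasis (Fin (n + 2)) ℝ (E n)

/-- The open simplex: all barycentric coordinates are positive. -/
def openElem {n : ℕ} (e : BulkSimplex n) : Set (E n) := {x | ∀ i, 0 < e.coord i x}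

/-- The closed simplex: all barycentric coordinates are nonnegative. -/
def closedElem {n : ℕ} (e : BulkSimplex n) : Set (E n) := {x | ∀ i, 0 ≤ e.coord i x}

/-- A regular (conforming) partitioning of the polyhedral domain `Ω` into disjoint open
simplices. -/
structure IsTriangulation {n N : ℕ} (Ω : Set (E n)) (mesh : Fin N → BulkSimplex n) : Prop where
  subset : ∀ e, openElem (mesh e) ⊆ Ω
  disjoint : Pairwise fun e e' => Disjoint (openElem (mesh e)) (openElem (mesh e'))
  cover : closure Ω = ⋃ e, closedElem (mesh e)
  conforming : ∀ e e', closedElem (mesh e) ∩ closedElem (mesh e') =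
    convexHull ℝ (range (mesh e) ∩ range (mesh e'))

/-- Quadratic Lagrange interpolation on one simplex; the nodes are the vertices and the edge
midpoints. -/
def localInterp {n : ℕ} (e : BulkSimplex n) (η : E n → E n) (x : E n) : E n :=
  (∑ i, (e.coord i x * (2 * e.coord i x - 1)) • η (e i)) +
    ∑ i, ∑ j ∈ Finset.univ.filter (fun j => i < j),
      (4 * e.coord i x * e.coord j x) • η (midpoint ℝ (e i) (e j))

open Classical in
/-- The interpolation operator onto continuous piecewise quadratic vector fields. On a
conforming mesh the value does not depend on the chosen simplex that contains `x`. -/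
def interp {n N : ℕ} (mesh : Fin N → BulkSimplex n) (η : E n → E n) (x : E n) : E n :=
  if h : ∃ e, x ∈ closedElem (mesh e) then localInterp (mesh h.choose) η x else 0

/-- `ν` is the outer unit normal of `Ω` at `x`, a point near which the boundary is flat
(all points of the boundary of a polyhedron, up to lower dimensional faces). -/
def IsOuterNormal {n : ℕ} (Ω : Set (E n)) (x ν : E n) : Prop :=
  ‖ν‖ = 1 ∧ ∃ r > 0, Ω ∩ Metric.ball x r = {y ∈ Metric.ball x r | inner ℝ (y - x) ν < 0}

/-- `Uh` is a finite element velocity space: continuous vector fields on `closure Ω`, piecewise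
polynomial on the mesh with some bound `k` on the degree, vanishing on `bd1` (no slip), with
vanishing normal component on `bd2` (free slip). The boundary conditions hold almost everywhere
for the surface measure. -/
structure IsVelocitySpace {n N : ℕ} (Ω bd1 bd2 : Set (E n)) (mesh : Fin N → BulkSimplex n)
    (Uh : Submodule ℝ (CBar Ω)) : Prop where
  poly : ∃ k : ℕ, ∀ φ ∈ Uh, ∀ e, ∃ p : Fin (n + 1) → MvPolynomial (Fin (n + 1)) ℝ,
    (∀ i, (p i).totalDegree ≤ k) ∧
    ∀ x ∈ openElem (mesh e), ∀ i, ext φ x i = MvPolynomial.eval (fun l => x l) (p i)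
  no_slip : ∀ φ ∈ Uh, ∀ᵐ x ∂((Measure.hausdorffMeasure (n : ℝ)).restrict bd1), ext φ x = 0
  free_slip : ∀ φ ∈ Uh, ∀ᵐ x ∂((Measure.hausdorffMeasure (n : ℝ)).restrict bd2),
    ∀ ν, IsOuterNormal Ω x ν → inner ℝ (ext φ x) ν = 0

/-- `ξ ∈ H¹(0,T;Uh)` with weak time derivative `ξt ∈ L²(0,T;Uh)`; `ξ` is the continuous
representative. -/
structure IsH1 {n : ℕ} {Ω : Set (E n)} (T : ℝ) (Uh : Submodule ℝ (CBar Ω))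
    (ξ ξt : ℝ → CBar Ω) : Prop where
  mem : ∀ t ∈ Icc 0 T, ξ t ∈ Uh
  deriv_mem : ∀ᵐ t ∂(volume.restrict (Ioo 0 T)), ξt t ∈ Uh
  deriv_memLp : MemLp ξt 2 (volume.restrict (Ioo 0 T))
  eq_integral : ∀ t ∈ Icc 0 T, ξ t = ξ 0 + ∫ s in (0 : ℝ)..t, ξt s

/-- Pressures: `L²(Ω)`. -/
abbrev Pressure {n : ℕ} (Ω : Set (E n)) : Type := Lp ℝ 2 (volume.restrict Ω)

/-- The members of mean zero of a pressure space. -/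
def meanZero {n : ℕ} {Ω : Set (E n)} (Ph : Submodule ℝ (Pressure Ω)) : Set (Pressure Ω) :=
  {φ | φ ∈ Ph ∧ ∫ x in Ω, φ x = 0}

/-! ### Calculus on one flat surface simplex with vertices `v 0, …, v n` -/

def edge {n : ℕ} (v : Fin (n + 1) → E n) (a : Fin n) : E n := v a.succ - v 0

/-- Gram matrix of the edges, i.e. the first fundamental form of the affine parametrization. -/
def gramMat {n : ℕ} (v : Fin (n + 1) → E n) : Matrix (Fin n) (Fin n) ℝ :=
  Matrix.of fun a b => inner ℝ (edge v a) (edge v b)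

def refSimplex (n : ℕ) : Set (Fin n → ℝ) := {s | (∀ a, 0 ≤ s a) ∧ ∑ a, s a ≤ 1}

/-- Barycentric coordinates of the point of the simplex with parameter `s`. -/
def bary {n : ℕ} (s : Fin n → ℝ) : Fin (n + 1) → ℝ := Fin.cons (1 - ∑ a, s a) s

/-- Integral over the simplex with respect to `(d-1)`-dimensional surface measure, by the affine
parametrization over the reference simplex; the integrand is given as a function of the
barycentric coordinates. -/
def elemIntegral {n : ℕ} (v : Fin (n + 1) → E n) (g : (Fin (n + 1) → ℝ) → ℝ) : ℝ :=
  Real.sqrt (gramMat v).det * ∫ s in refSimplex n, g (bary s)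

/-- The `(d-1)`-dimensional measure of the simplex. -/
def area {n : ℕ} (v : Fin (n + 1) → E n) : ℝ := elemIntegral v fun _ => 1

/-- Surface gradient of the affine function with vertex values `f`: the tangential vector `g`
with `g · (v i - v 0) = f i - f 0` for all `i`. -/
def gradS {n : ℕ} (v : Fin (n + 1) → E n) (f : Fin (n + 1) → ℝ) : E n :=
  ∑ a, ∑ b, ((gramMat v)⁻¹ a b * (f b.succ - f 0)) • edge v a

/-- `(∇ₛ u) i j = ∂_{s_j} u_i` for the affine vector field with vertex values `u`. -/
def gradSVec {n : ℕ} (v : Fin (n + 1) → E n) (u : Fin (n + 1) → E n) :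
    Matrix (Fin (n + 1)) (Fin (n + 1)) ℝ :=
  Matrix.of fun i j => gradS v (fun m => u m i) j

def divS {n : ℕ} (v : Fin (n + 1) → E n) (u : Fin (n + 1) → E n) : ℝ := (gradSVec v u).trace

/-- The tangential projection `Id - ν ⊗ ν`: orthogonal projection onto the directions of the
simplex. -/
def tangProj {n : ℕ} (v : Fin (n + 1) → E n) : Matrix (Fin (n + 1)) (Fin (n + 1)) ℝ :=
  Matrix.of fun i j => ((vectorSpan ℝ (range v)).starProjection (EuclideanSpace.single j 1)) i

/-- `D_s(u) = P (∇ₛ u + (∇ₛ u)ᵀ) P / 2`. -/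
def symS {n : ℕ} (v : Fin (n + 1) → E n) (u : Fin (n + 1) → E n) :
    Matrix (Fin (n + 1)) (Fin (n + 1)) ℝ :=
  (1 / 2 : ℝ) • (tangProj v * (gradSVec v u + (gradSVec v u).transpose) * tangProj v)

/-- Deviatoric part `D_s(u) - (∇ₛ · u) P / (d - 1)`. -/
def devS {n : ℕ} (v : Fin (n + 1) → E n) (u : Fin (n + 1) → E n) :
    Matrix (Fin (n + 1)) (Fin (n + 1)) ℝ :=
  symS v u - ((1 / (n : ℝ)) * divS v u) • tangProj v

/-! ### Polyhedral surfaces and their finite element functions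

A surface has `K` vertices `q k`, and simplices `j` with vertices `q (σ j i)`. A continuous
piecewise linear function is represented by its vertex values (its coefficients in the standard
basis). -/

/-- The vertex values of element `j`. -/
def loc {n K J : ℕ} {α : Type} (σ : Fin J → Fin (n + 1) → Fin K) (z : Fin K → α) (j : Fin J) :
    Fin (n + 1) → α := fun i => z (σ j i)

/-- The polyhedral surface, i.e. the union of its closed simplices. -/
def surface {n K J : ℕ} (σ : Fin J → Fin (n + 1) → Fin K) (q : Fin K → E n) : Set (E n) :=
  ⋃ j, convexHull ℝ (range (loc σ q j))

/-- Relatively open simplex. -/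
def openFace {n : ℕ} (v : Fin (n + 1) → E n) : Set (E n) :=
  {x | ∃ w : Fin (n + 1) → ℝ, (∀ i, 0 < w i) ∧ ∑ i, w i = 1 ∧ x = ∑ i, w i • v i}

/-- Union of nondegenerate, mutually disjoint open simplices without hanging vertices; the
points `q k` are distinct and are exactly the vertices of these simplices. -/
structure IsPolyhedral {n K J : ℕ} (σ : Fin J → Fin (n + 1) → Fin K) (q : Fin K → E n) :
    Prop where
  nondegenerate : ∀ j, AffineIndependent ℝ (loc σ q j)
  injective : Function.Injective q
  vertex_used : ∀ k, ∃ j i, σ j i = k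
  disjoint : Pairwise fun j j' => Disjoint (openFace (loc σ q j)) (openFace (loc σ q j'))
  no_hanging : ∀ j j', convexHull ℝ (range (loc σ q j)) ∩ convexHull ℝ (range (loc σ q j')) =
    convexHull ℝ (range (loc σ q j) ∩ range (loc σ q j'))

/-- The closed surface `Γ ⊆ Ω` separates `Ω` into its interior `Ωm` and its exterior `Ωp`. -/
structure Separates {n : ℕ} (Ω Γ Ωm Ωp : Set (E n)) : Prop where
  subset : Γ ⊆ Ω
  isOpen_int : IsOpen Ωm
  isOpen_ext : IsOpen Ωp
  disjoint : Disjoint Ωm Ωp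
  union : Ωm ∪ Ωp = Ω \ Γ
  boundary : frontier Ωm = Γ
  interface : closure Ωm ∩ closure Ωp = Γ

/-- The value of the piecewise linear function with vertex values `z` at the point of element
`j` with barycentric coordinates `w`. -/
def feVal {n K J : ℕ} (σ : Fin J → Fin (n + 1) → Fin K) (z : Fin K → ℝ) (j : Fin J)
    (w : Fin (n + 1) → ℝ) : ℝ := ∑ i, w i * z (σ j i)

/-- `⟨g, 1⟩` on the surface; `g j` is the restriction to element `j` as a function of the
barycentric coordinates. -/
def surfInt {n K J : ℕ} (σ : Fin J → Fin (n + 1) → Fin K) (q : Fin K → E n)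
    (g : Fin J → (Fin (n + 1) → ℝ) → ℝ) : ℝ := ∑ j, elemIntegral (loc σ q j) (g j)

/-- The mass lumped inner product: `⟨η, ζ⟩ʰ = lump (η ζ)`, where `g j i` is the limit of the
integrand at vertex `i` of element `j`, taken from inside that element. -/
def lump {n K J : ℕ} (σ : Fin J → Fin (n + 1) → Fin K) (q : Fin K → E n)
    (g : Fin J → Fin (n + 1) → ℝ) : ℝ :=
  (1 / ((n : ℝ) + 1)) * ∑ j, area (loc σ q j) * ∑ i, g j i

/-- Time derivative of vertex values that travel with the vertices, on `[0,T]`. For `z = q` it is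
the discrete velocity, for a finite element function it is the discrete material derivative. -/
def dt {K : ℕ} {V : Type} [NormedAddCommGroup V] [NormedSpace ℝ V] (T : ℝ)
    (z : ℝ → Fin K → V) (t : ℝ) (k : Fin K) : V :=
  derivWithin (fun s => z s k) (Icc 0 T) t

/-- Continuous piecewise linear functions on the space-time surface whose material derivative is
continuous. -/
def IsWT {K : ℕ} {V : Type} [NormedAddCommGroup V] [NormedSpace ℝ V] (T : ℝ)
    (z : ℝ → Fin K → V) : Prop :=
  ∀ k, ContDiffOn ℝ 1 (fun s => z s k) (Icc 0 T)

/-! ### Physical data -/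

/-- Densities, viscosities, diffusivity, interfacial viscosities, surface tension `γ` and surface
energy density `F`; `psiInf` may be infinite. -/
structure Phys (n : ℕ) where
  (rhoM rhoP muM muP DG : ℝ)
  (muG lamG γ F : ℝ → ℝ)
  psiInf : EReal
  rhoM_pos : 0 < rhoM
  rhoP_pos : 0 < rhoP
  muM_pos : 0 < muM
  muP_pos : 0 < muP
  DG_nonneg : 0 ≤ DG
  muG_cont : Continuous muG
  muG_nonneg : ∀ r, 0 ≤ muG r
  lamG_cont : Continuous lamG
  lamG_bound : ∀ r, 0 ≤ lamG r + 2 / (n : ℝ) * muG r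
  psiInf_pos : 0 < psiInf
  γ_smooth : ContDiffOn ℝ 1 γ {r : ℝ | 0 ≤ r ∧ (r : EReal) < psiInf}
  γ_mono : ∀ r : ℝ, 0 ≤ r → (r : EReal) < psiInf →
    derivWithin γ {r : ℝ | 0 ≤ r ∧ (r : EReal) < psiInf} r ≤ 0
  F_diff : ∀ r : ℝ, 0 < r → (r : EReal) < psiInf → DifferentiableAt ℝ F r
  F_eq : ∀ r : ℝ, 0 < r → (r : EReal) < psiInf → γ r = F r - r * deriv F r
  F_lim : Tendsto (fun r => r * deriv F r) (𝓝[>] 0) (𝓝 0)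
  F_zero : F 0 = γ 0

open Classical in
/-- The piecewise constant coefficient with value `am` on elements inside `Ωm`, `ap` on elements
inside `Ωp`, and the average on the remaining elements, which are those that meet the
surface. -/
def phaseCoeff {n N : ℕ} (mesh : Fin N → BulkSimplex n) (Ωm Ωp : Set (E n)) (am ap : ℝ)
    (x : E n) : ℝ :=
  ∑ e, (openElem (mesh e)).indicator (fun _ =>
    if openElem (mesh e) ⊆ Ωm then am else if openElem (mesh e) ⊆ Ωp then ap
    else (1 / 2) * (am + ap)) x

/-! ### The semi-discrete scheme -/

/-- The unknowns: vertices `q` of the moving surface (with the interior `Ωm` and exterior `Ωp`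
that it determines), surface density, velocity and its weak time derivative, pressure, curvature
vector, and surfactant concentration. -/
structure Fields (n K : ℕ) (Ω : Set (E n)) where
  q : ℝ → Fin K → E n
  Ωm : ℝ → Set (E n)
  Ωp : ℝ → Set (E n)
  rhoG : ℝ → Fin K → ℝ
  U : ℝ → CBar Ω
  Ut : ℝ → CBar Ω
  P : ℝ → Pressure Ω
  kappa : ℝ → Fin K → E n
  Psi : ℝ → Fin K → ℝ

section Scheme

variable {n N K J : ℕ} {Ω : Set (E n)}

/-- Values at the moving vertices of a bulk field. -/
def trace (S : Fields n K Ω) (ξ : ℝ → CBar Ω) (t : ℝ) (k : Fin K) : E n := ext (ξ t) (S.q t k)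

/-- Discrete density. -/
def rhoh (ph : Phys n) (mesh : Fin N → BulkSimplex n) (S : Fields n K Ω) (t : ℝ) : E n → ℝ :=
  phaseCoeff mesh (S.Ωm t) (S.Ωp t) ph.rhoM ph.rhoP

/-- Discrete viscosity. -/
def muh (ph : Phys n) (mesh : Fin N → BulkSimplex n) (S : Fields n K Ω) (t : ℝ) : E n → ℝ :=
  phaseCoeff mesh (S.Ωm t) (S.Ωp t) ph.muM ph.muP

/-- `(ρʰ u, ξ)` at time `t`. -/
def massForm (ph : Phys n) (mesh : Fin N → BulkSimplex n) (S : Fields n K Ω)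
    (u ξ : ℝ → CBar Ω) (t : ℝ) : ℝ :=
  ∫ x in Ω, rhoh ph mesh S t x * inner ℝ (ext (u t) x) (ext (ξ t) x)

/-- `(μʰ D(u), D(ξ))` at time `t`. -/
def viscForm (ph : Phys n) (mesh : Fin N → BulkSimplex n) (S : Fields n K Ω)
    (u ξ : ℝ → CBar Ω) (t : ℝ) : ℝ :=
  ∫ x in Ω, muh ph mesh S t x * frob (bulkSym (ext (u t)) x) (bulkSym (ext (ξ t)) x)

/-- `(ρʰ, [(I u · ∇) u] · ξ - [(I u · ∇) ξ] · u)` at time `t`, `I` the quadratic interpolation. -/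
def convForm (ph : Phys n) (mesh : Fin N → BulkSimplex n) (S : Fields n K Ω)
    (u ξ : ℝ → CBar Ω) (t : ℝ) : ℝ :=
  ∫ x in Ω, rhoh ph mesh S t x *
    (inner ℝ (fderiv ℝ (ext (u t)) x (interp mesh (ext (u t)) x)) (ext (ξ t) x) -
      inner ℝ (fderiv ℝ (ext (ξ t)) x (interp mesh (ext (u t)) x)) (ext (u t) x))

/-- `(ρʰ f₁ʰ + f₂ʰ, ξ)` at time `t`. -/
def forceForm (ph : Phys n) (mesh : Fin N → BulkSimplex n) (S : Fields n K Ω)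
    (f₁ f₂ ξ : ℝ → CBar Ω) (t : ℝ) : ℝ :=
  ∫ x in Ω, inner ℝ (rhoh ph mesh S t x • interp mesh (ext (f₁ t)) x +
    interp mesh (ext (f₂ t)) x) (ext (ξ t) x)

/-- `⟨ρ_Γ u, ξ⟩ʰ` at time `t`. -/
def surfMassForm (σ : Fin J → Fin (n + 1) → Fin K) (S : Fields n K Ω)
    (u ξ : ℝ → CBar Ω) (t : ℝ) : ℝ :=
  lump σ (S.q t) fun j i =>
    S.rhoG t (σ j i) * inner ℝ (trace S u t (σ j i)) (trace S ξ t (σ j i))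

/-- `⟨∇ₛ ψ, ∇ₛ χ⟩` on the surface with vertices `q`. -/
def diffForm (σ : Fin J → Fin (n + 1) → Fin K) (q : Fin K → E n) (ψ χ : Fin K → ℝ) : ℝ :=
  surfInt σ q fun j _ =>
    inner ℝ (gradS (loc σ q j) (loc σ ψ j)) (gradS (loc σ q j) (loc σ χ j))

/-- `S` solves the semi-discrete scheme on `[0,T]`. The time derivatives of the inner products are
pointwise derivatives, whose existence at almost every time is part of the scheme. -/
structure IsSolution (T : ℝ) (mesh : Fin N → BulkSimplex n) (Uh : Submodule ℝ (CBar Ω))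
    (Ph : ℝ → Submodule ℝ (Pressure Ω)) (ph : Phys n) (f₁ f₂ : ℝ → CBar Ω)
    (σ : Fin J → Fin (n + 1) → Fin K) (S : Fields n K Ω) : Prop where
  /-- the surface at each time, and differentiability of the vertex trajectories -/
  polyhedral : ∀ t ∈ Icc 0 T, IsPolyhedral σ (S.q t)
  separates : ∀ t ∈ Icc 0 T, Separates Ω (surface σ (S.q t)) (S.Ωm t) (S.Ωp t)
  q_diff : ∀ k, DifferentiableOn ℝ (fun t => S.q t k) (Icc 0 T)
  /-- function spaces -/
  rhoG_mem : IsWT T S.rhoG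
  U_mem : IsH1 T Uh S.U S.Ut
  U_trace : IsWT T (trace S S.U)
  P_memLp : MemLp S.P 2 (volume.restrict (Ioo 0 T))
  P_mem : ∀ᵐ t ∂(volume.restrict (Ioo 0 T)), S.P t ∈ meanZero (Ph t)
  kappa_cont : ∀ k, ContinuousOn (fun t => S.kappa t k) (Icc 0 T)
  Psi_mem : IsWT T S.Psi
  /-- surface mass transport -/
  density : ∀ ζ : ℝ → Fin K → ℝ, IsWT T ζ → ∀ᵐ t ∂(volume.restrict (Ioo 0 T)),
    HasDerivAt (fun s => lump σ (S.q s) fun j i => S.rhoG s (σ j i) * ζ s (σ j i))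
      (lump σ (S.q t) fun j i => S.rhoG t (σ j i) * dt T ζ t (σ j i)) t
  /-- momentum -/
  momentum : ∀ ξ ξt : ℝ → CBar Ω, IsH1 T Uh ξ ξt → ∀ᵐ t ∂(volume.restrict (Ioo 0 T)),
    ∃ a b : ℝ, HasDerivAt (massForm ph mesh S S.U ξ) a t ∧
      HasDerivAt (surfMassForm σ S S.U ξ) b t ∧
      (1 / 2) * (a + massForm ph mesh S S.Ut ξ t - massForm ph mesh S S.U ξt t)
        + 2 * viscForm ph mesh S S.U ξ t
        + (1 / 2) * convForm ph mesh S S.U ξ t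
        - (∫ x in Ω, S.P t x * bulkDiv (ext (ξ t)) x)
        + b
        + 2 * (lump σ (S.q t) fun j i => ph.muG (S.Psi t (σ j i)) *
            frob (symS (loc σ (S.q t) j) (loc σ (trace S S.U t) j))
              (symS (loc σ (S.q t) j) (loc σ (trace S ξ t) j)))
        + (lump σ (S.q t) fun j i => ph.lamG (S.Psi t (σ j i)) *
            divS (loc σ (S.q t) j) (loc σ (trace S S.U t) j) *
              divS (loc σ (S.q t) j) (loc σ (trace S ξ t) j))
        - (lump σ (S.q t) fun j i =>
            inner ℝ (ph.γ (S.Psi t (σ j i)) • S.kappa t (σ j i) +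
              gradS (loc σ (S.q t) j) (loc σ (fun k => ph.γ (S.Psi t k)) j))
              (trace S ξ t (σ j i)))
      = forceForm ph mesh S f₁ f₂ ξ t
        + lump σ (S.q t) fun j i => S.rhoG t (σ j i) *
            inner ℝ (trace S S.U t (σ j i)) (dt T (trace S ξ) t (σ j i))
  /-- incompressibility -/
  incompressible : ∀ᵐ t ∂(volume.restrict (Ioo 0 T)), ∀ φ ∈ meanZero (Ph t),
    ∫ x in Ω, bulkDiv (ext (S.U t)) x * φ x = 0
  /-- the vertices move with the fluid -/
  velocity : ∀ᵐ t ∂(volume.restrict (Ioo 0 T)), ∀ χ : Fin K → E n,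
    (lump σ (S.q t) fun j i => inner ℝ (dt T S.q t (σ j i)) (χ (σ j i))) =
      lump σ (S.q t) fun j i => inner ℝ (trace S S.U t (σ j i)) (χ (σ j i))
  /-- curvature -/
  curvature : ∀ᵐ t ∂(volume.restrict (Ioo 0 T)), ∀ η : Fin K → E n,
    (lump σ (S.q t) fun j i => inner ℝ (S.kappa t (σ j i)) (η (σ j i))) +
      (surfInt σ (S.q t) fun j _ => frob (gradSVec (loc σ (S.q t) j) (loc σ (S.q t) j))
        (gradSVec (loc σ (S.q t) j) (loc σ η j))) = 0
  /-- surfactant transport -/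
  surfactant : ∀ χ : ℝ → Fin K → ℝ, IsWT T χ → ∀ᵐ t ∂(volume.restrict (Ioo 0 T)),
    ∃ a : ℝ, HasDerivAt (fun s => lump σ (S.q s) fun j i => S.Psi s (σ j i) * χ s (σ j i)) a t ∧
      a + ph.DG * diffForm σ (S.q t) (S.Psi t) (χ t) =
        lump σ (S.q t) fun j i => S.Psi t (σ j i) * dt T χ t (σ j i)

/-- Total amount of surfactant `⟨Ψ, 1⟩`. -/
def totalSurfactant (σ : Fin J → Fin (n + 1) → Fin K) (S : Fields n K Ω) (t : ℝ) : ℝ :=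
  surfInt σ (S.q t) fun j w => feVal σ (S.Psi t) j w

/-- `Ψ(·,t) ≥ 0` on the whole surface. -/
def PsiNonneg (σ : Fin J → Fin (n + 1) → Fin K) (S : Fields n K Ω) (t : ℝ) : Prop :=
  ∀ j, ∀ w ∈ stdSimplex ℝ (Fin (n + 1)), 0 ≤ feVal σ (S.Psi t) j w

/-- `Ψ(·,t) < ψ_∞` on the whole surface. -/
def PsiBelow (ph : Phys n) (σ : Fin J → Fin (n + 1) → Fin K) (S : Fields n K Ω) (t : ℝ) : Prop :=
  ∀ j, ∀ w ∈ stdSimplex ℝ (Fin (n + 1)), ((feVal σ (S.Psi t) j w : ℝ) : EReal) < ph.psiInf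

/-- `∫_{σ_j(t)} ∇ₛ χ_i · ∇ₛ χ_k ≤ 0` for all distinct standard basis functions, all elements, and
all times. -/
def NonObtuse (T : ℝ) (σ : Fin J → Fin (n + 1) → Fin K) (S : Fields n K Ω) : Prop :=
  ∀ t ∈ Icc 0 T, ∀ j, ∀ i k : Fin K, i ≠ k →
    elemIntegral (loc σ (S.q t) j) (fun _ =>
      inner ℝ (gradS (loc σ (S.q t) j) (loc σ (Pi.single i (1 : ℝ)) j))
        (gradS (loc σ (S.q t) j) (loc σ (Pi.single k (1 : ℝ)) j))) ≤ 0

/-- `max_{0 ≤ t ≤ T} ‖∇ₛ · Vʰ‖_∞ < ∞`; the divergence is constant on each element. -/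
def DivBounded (T : ℝ) (σ : Fin J → Fin (n + 1) → Fin K) (S : Fields n K Ω) : Prop :=
  ∃ C : ℝ, ∀ t ∈ Icc 0 T, ∀ j, |divS (loc σ (S.q t) j) (loc σ (dt T S.q t) j)| ≤ C

/-- `½ ‖ρ^{1/2} U‖² + ½ ⟨ρ_Γ U, U⟩ʰ + ⟨F(Ψ), 1⟩ʰ`. -/
def energy (ph : Phys n) (mesh : Fin N → BulkSimplex n) (σ : Fin J → Fin (n + 1) → Fin K)
    (S : Fields n K Ω) (t : ℝ) : ℝ :=
  (1 / 2) * (∫ x in Ω, ‖Real.sqrt (rhoh ph mesh S t x) • ext (S.U t) x‖ ^ 2)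
    + (1 / 2) * surfMassForm σ S S.U S.U t
    + lump σ (S.q t) fun j i => ph.F (S.Psi t (σ j i))

/-- The bulk and surface dissipation terms. -/
def dissipation (ph : Phys n) (mesh : Fin N → BulkSimplex n) (σ : Fin J → Fin (n + 1) → Fin K)
    (S : Fields n K Ω) (t : ℝ) : ℝ :=
  2 * (∫ x in Ω, frob (Real.sqrt (muh ph mesh S t x) • bulkSym (ext (S.U t)) x)
      (Real.sqrt (muh ph mesh S t x) • bulkSym (ext (S.U t)) x))
    + 2 * (lump σ (S.q t) fun j i => ph.muG (S.Psi t (σ j i)) *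
        frob (devS (loc σ (S.q t) j) (loc σ (trace S S.U t) j))
          (devS (loc σ (S.q t) j) (loc σ (trace S S.U t) j)))
    + lump σ (S.q t) fun j i =>
        (ph.lamG (S.Psi t (σ j i)) + 2 / (n : ℝ) * ph.muG (S.Psi t (σ j i))) *
          divS (loc σ (S.q t) j) (loc σ (trace S S.U t) j) *
          divS (loc σ (S.q t) j) (loc σ (trace S S.U t) j)

end Scheme

end TwoPhase

end

namespace TwoPhase

/-! Mass lumping turns the surfactant equation into a linear ODE system for the nodal amounts y_k =
m_k Ψ_k, where m_k is the lumped mass of vertex k. All three conclusions use this.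

The equation is given only for almost every time, with a null set depending on the test function.
For nodal values χ constant in time, ⟨Ψ, χ⟩ʰ is differentiable at every time and its derivative
agrees almost everywhere with the continuous function -D ⟨∇Ψ, ∇χ⟩, hence everywhere
(`hasDerivWithinAt_of_ae_eq`, `IsSolution.surfactant_everywhere`). The choice χ = 1 gives
conservation, because vertex quadrature is exact for affine functions (`elemIntegral_affine`).

Hat functions as χ give y' = B y (`IsSolution.nodal_ode`). The entries of B are continuous in time,
hence bounded, and are nonnegative off the diagonal when D = 0 or the angle condition holds. A
Gronwall estimate for the sum of squared negative parts then preserves the sign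
(`nonneg_of_quasipositive`).

For the energy, momentum is tested with U and mass transport with |U|² at the vertices. Convection
and pressure drop out, and testing the curvature equation with γ(Ψ)U turns the surface tension term
into ⟨γ(Ψ), ∇·U⟩ʰ (`curvature_identity`). It remains to bound the derivative of ⟨F(Ψ), 1⟩ʰ by this
quantity (`IsSolution.surfaceEnergy_deriv`). With g = F'(Ψ) and F = γ + Ψ F', the difference is the
derivative of ⟨Ψ, g⟩ʰ with g frozen, that is -D ⟨∇Ψ, ∇g⟩. It is nonpositive on segments because F'
is nondecreasing.

F' may be singular at 0. But e^{Ct} y_k is nondecreasing, so a vertex value once positive stays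
positive. Except at one time per vertex at most, a value is therefore positive or zero in a whole
neighbourhood of the time. In the second case Ψ_k' = 0 and F(0) = γ(0), so any number may replace
the slope, and one below all other slopes keeps g monotone (`Phys.exists_slopes`). -/

/-! ### Analysis on a time interval -/

/-- If an everywhere differentiable function has a derivative that agrees almost everywhere with a
continuous function, then it agrees everywhere. -/
theorem hasDerivWithinAt_of_ae_eq {f f' g : ℝ → ℝ} {T : ℝ}
    (hf : ∀ t ∈ Icc 0 T, HasDerivWithinAt f (f' t) (Icc 0 T) t)
    (hg : ContinuousOn g (Icc 0 T))
    (hfg : ∀ᵐ t ∂(volume.restrict (Ioo 0 T)), f' t = g t) :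
    ∀ t ∈ Icc 0 T, HasDerivWithinAt f (g t) (Icc 0 T) t := by
  intro t ht
  have hT : 0 ≤ T := ht.1.trans ht.2
  -- Constant extension beyond the end points makes the integrand continuous on the whole line, so
  -- its primitive is differentiable at the end points too.
  set G : ℝ → ℝ := IccExtend hT ((Icc 0 T).domRestrict g) with hG
  have hGc : Continuous G := (continuousOn_iff_continuous_domRestrict.1 hg).Icc_extend'
  have hGe : ∀ s ∈ Icc 0 T, G s = g s := fun s hs => by
    rw [hG, IccExtend_of_mem hT _ hs]; rfl
  have hint : ∀ s ∈ Icc 0 T, f s = f 0 + ∫ r in (0 : ℝ)..s, G r := by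
    intro s hs
    have hae : ∀ᵐ r ∂(volume.restrict (uIoc 0 s)), f' r = G r := by
      rw [uIoc_of_le hs.1]
      have h1 : ∀ᵐ r ∂(volume.restrict (Ioc 0 T)), f' r = g r := by
        rwa [← Measure.restrict_congr_set Ioo_ae_eq_Ioc]
      have h2 : ∀ᵐ r ∂(volume.restrict (Ioc 0 s)), f' r = g r :=
        ae_restrict_of_ae_restrict_of_subset (Ioc_subset_Ioc_right hs.2) h1
      filter_upwards [h2, ae_restrict_mem measurableSet_Ioc] with r hr hrm
      rw [hr, hGe r ⟨hrm.1.le, hrm.2.trans hs.2⟩]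
    -- A derivative need not be integrable in general; here integrability is inherited from the
    -- continuous representative.
    have hii : IntervalIntegrable f' volume 0 s :=
      (hGc.intervalIntegrable 0 s).congr_ae (EventuallyEq.symm hae)
    have hftc := intervalIntegral.integral_eq_sub_of_hasDerivAt_of_le hs.1
      (fun r hr => ((hf r ⟨hr.1, hr.2.trans hs.2⟩).continuousWithinAt).mono
        (Icc_subset_Icc_right hs.2))
      (fun r hr => (hf r ⟨hr.1.le, hr.2.le.trans hs.2⟩).hasDerivAt
        (Icc_mem_nhds hr.1 (hr.2.trans_le hs.2))) hii
    rw [← intervalIntegral.integral_congr_ae_restrict hae, hftc]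
    ring
  have hd : HasDerivAt (fun s => f 0 + ∫ r in (0 : ℝ)..s, G r) (G t) t :=
    (hGc.integral_hasStrictDerivAt 0 t).hasDerivAt.const_add _
  rw [← hGe t ht]
  exact hd.hasDerivWithinAt.congr hint (hint t ht)

/-- Gronwall's inequality with the integrating factor e^{Ct}. It serves twice: for the decay of the
negative parts and for the persistence of positive vertex values. -/
theorem monotoneOn_exp_mul {f f' : ℝ → ℝ} {C T : ℝ}
    (hf : ∀ t ∈ Icc 0 T, HasDerivWithinAt f (f' t) (Icc 0 T) t)
    (hC : ∀ t ∈ Icc 0 T, -(C * f t) ≤ f' t) :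
    MonotoneOn (fun t => Real.exp (C * t) * f t) (Icc 0 T) := by
  have hd : ∀ t ∈ Icc 0 T, HasDerivWithinAt (fun t => Real.exp (C * t) * f t)
      (Real.exp (C * t) * (C * f t + f' t)) (Icc 0 T) t := by
    intro t ht
    have h1 : HasDerivWithinAt (fun t => Real.exp (C * t)) (Real.exp (C * t) * C) (Icc 0 T) t := by
      simpa using ((hasDerivAt_id t).const_mul C).exp.hasDerivWithinAt
    exact (h1.mul (hf t ht)).congr_deriv (by ring)
  refine monotoneOn_of_hasDerivWithinAt_nonneg (convex_Icc 0 T)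
    (fun t ht => (hd t ht).continuousWithinAt)
    (fun t ht => (hd t (interior_subset ht)).mono interior_subset) (fun t ht => ?_)
  have := hC t (interior_subset ht)
  exact mul_nonneg (Real.exp_pos _).le (by linarith)

/-- Squaring removes the kink of the negative part: at 0 the function is dominated by x², hence is
o(x). -/
theorem hasDerivAt_sq_min_zero (x : ℝ) :
    HasDerivAt (fun x : ℝ => (min x 0) ^ 2) (2 * min x 0) x := by
  rcases lt_trichotomy x 0 with h | h | h
  · have : (fun x : ℝ => (min x 0) ^ 2) =ᶠ[𝓝 x] fun x => x ^ 2 := by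
      filter_upwards [Iio_mem_nhds h] with y hy
      rw [min_eq_left (le_of_lt hy)]
    rw [min_eq_left h.le]
    have hsq : HasDerivAt (fun x : ℝ => x ^ 2) (2 * x) x := by simpa using hasDerivAt_pow 2 x
    exact hsq.congr_of_eventuallyEq this
  · subst h
    have hO : (fun x : ℝ => (min x 0) ^ 2) =O[𝓝 0] fun x => x ^ 2 := by
      refine Asymptotics.IsBigO.of_norm_le (fun y => ?_)
      rw [Real.norm_eq_abs, abs_of_nonneg (sq_nonneg _)]
      rcases le_total y 0 with hy | hy
      · rw [min_eq_left hy]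
      · rw [min_eq_right hy, zero_pow two_ne_zero]; exact sq_nonneg y
    rw [hasDerivAt_iff_isLittleO]
    simpa using hO.trans_isLittleO (by simpa using Asymptotics.isLittleO_pow_id (n := 2) one_lt_two)
  · have : (fun x : ℝ => (min x 0) ^ 2) =ᶠ[𝓝 x] fun _ => 0 := by
      filter_upwards [Ioi_mem_nhds h] with y hy
      rw [min_eq_right (le_of_lt hy)]; norm_num
    rw [min_eq_right h.le, mul_zero]
    exact (hasDerivAt_const x (0 : ℝ)).congr_of_eventuallyEq this

/-- A linear system with bounded, off-diagonally nonnegative coefficients preserves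
nonnegativity. -/
theorem nonneg_of_quasipositive {ι : Type*} [Fintype ι] {T C : ℝ} {y : ℝ → ι → ℝ}
    {B : ℝ → ι → ι → ℝ}
    (hy : ∀ t ∈ Icc 0 T, ∀ k,
      HasDerivWithinAt (fun s => y s k) (∑ l, B t k l * y t l) (Icc 0 T) t)
    (hB : ∀ t ∈ Icc 0 T, ∀ k l, k ≠ l → 0 ≤ B t k l)
    (hC : ∀ t ∈ Icc 0 T, ∀ k l, |B t k l| ≤ C) (h0 : ∀ k, 0 ≤ y 0 k) :
    ∀ t ∈ Icc 0 T, ∀ k, 0 ≤ y t k := by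
  intro t ht k
  set f : ℝ → ℝ := fun s => ∑ k, (min (y s k) 0) ^ 2 with hfdef
  have hf : ∀ s ∈ Icc 0 T, HasDerivWithinAt f
      (∑ k, 2 * min (y s k) 0 * ∑ l, B s k l * y s l) (Icc 0 T) s := fun s hs =>
    HasDerivWithinAt.fun_sum fun k _ =>
      HasDerivAt.comp_hasDerivWithinAt (h₂ := fun x : ℝ => (min x 0) ^ 2) s
        (hasDerivAt_sq_min_zero (y s k)) (hy s hs k)
  have hterm : ∀ s ∈ Icc 0 T, ∀ k l, 2 * min (y s k) 0 * (B s k l * y s l) ≤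
      C * ((min (y s k) 0) ^ 2 + (min (y s l) 0) ^ 2) := by
    intro s hs k l
    have hc := abs_le.1 (hC s hs k l)
    by_cases hkl : k = l
    · subst hkl
      have : min (y s k) 0 * y s k = (min (y s k) 0) ^ 2 := by
        rcases le_total (y s k) 0 with h | h
        · rw [min_eq_left h]; ring
        · rw [min_eq_right h]; ring
      nlinarith [mul_nonneg (sub_nonneg.2 hc.2) (sq_nonneg (min (y s k) 0))]
    -- With a, b ≤ 0 the negative parts of y_k, y_l, the signs of B and a allow y_l to be replaced
    -- by b; then 2Bab ≤ B(a² + b²) ≤ C(a² + b²).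
    · have hb := hB s hs k l hkl
      have h1 : min (y s k) 0 ≤ 0 := min_le_right _ _
      have h2 : min (y s l) 0 ≤ y s l := min_le_left _ _
      have h3 : min (y s k) 0 * (B s k l * y s l) ≤ min (y s k) 0 * (B s k l * min (y s l) 0) :=
        mul_le_mul_of_nonpos_left (mul_le_mul_of_nonneg_left h2 hb) h1
      nlinarith [mul_nonneg hb (sq_nonneg (min (y s k) 0 - min (y s l) 0)),
        mul_nonneg (sub_nonneg.2 hc.2)
          (add_nonneg (sq_nonneg (min (y s k) 0)) (sq_nonneg (min (y s l) 0)))]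
  have hle : ∀ s ∈ Icc 0 T, (∑ k, 2 * min (y s k) 0 * ∑ l, B s k l * y s l) ≤
      2 * C * Fintype.card ι * f s := by
    intro s hs
    calc (∑ k, 2 * min (y s k) 0 * ∑ l, B s k l * y s l)
        = ∑ k, ∑ l, 2 * min (y s k) 0 * (B s k l * y s l) := by simp_rw [Finset.mul_sum]
      _ ≤ ∑ k, ∑ l, C * ((min (y s k) 0) ^ 2 + (min (y s l) 0) ^ 2) :=
          Finset.sum_le_sum fun k _ => Finset.sum_le_sum fun l _ => hterm s hs k l
      _ = 2 * C * Fintype.card ι * f s := by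
          simp only [← Finset.mul_sum, Finset.sum_add_distrib, Finset.sum_const,
            Finset.card_univ, nsmul_eq_mul, hfdef]
          ring
  -- Applied to -f with a negative constant: e^{-ct} f(t) is nonincreasing, and f vanishes
  -- initially.
  have hmono := monotoneOn_exp_mul (f := fun s => -f s) (C := -(2 * C * Fintype.card ι))
    (fun s hs => (hf s hs).neg) (fun s hs => by have := hle s hs; linarith)
  have h00 : f 0 = 0 := Finset.sum_eq_zero fun k _ => by rw [min_eq_right (h0 k)]; norm_num
  have hT : (0 : ℝ) ∈ Icc 0 T := ⟨le_rfl, ht.1.trans ht.2⟩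
  have h1 := hmono hT ht ht.1
  simp only [h00, neg_zero, mul_zero] at h1
  have h2 : f t ≤ 0 := by
    by_contra hcon
    push Not at hcon
    have := mul_pos (Real.exp_pos (-(2 * C * Fintype.card ι) * t)) hcon
    linarith
  have h3 : (min (y t k) 0) ^ 2 ≤ f t :=
    Finset.single_le_sum (f := fun k => (min (y t k) 0) ^ 2) (fun k _ => sq_nonneg _)
      (Finset.mem_univ k)
  have h4 : min (y t k) 0 = 0 := pow_eq_zero_iff two_ne_zero |>.1
    (le_antisymm (h3.trans h2) (sq_nonneg _))
  exact min_eq_right_iff.1 h4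

/-! ### Geometry of one surface simplex -/

theorem gramMat_det_pos {n : ℕ} {v : Fin (n + 1) → E n} (hv : AffineIndependent ℝ v) :
    0 < (gramMat v).det := by
  have h1 := (affineIndependent_iff_linearIndependent_vsub ℝ v 0).1 hv
  have h2 : LinearIndependent ℝ (edge v) := by
    have := h1.comp (fun a : Fin n => (⟨a.succ, Fin.succ_ne_zero a⟩ : {x : Fin (n + 1) // x ≠ 0}))
      (fun a b h => Fin.succ_injective _ (congrArg Subtype.val h))
    exact this
  exact (Matrix.posDef_gram_of_linearIndependent (𝕜 := ℝ) h2).det_pos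

theorem elemIntegral_const {n : ℕ} (v : Fin (n + 1) → E n) (c : ℝ) :
    elemIntegral v (fun _ => c) = area v * c := by
  simp [area, elemIntegral, mul_assoc]

theorem refSimplex_subset_Icc (n : ℕ) : refSimplex n ⊆ Icc 0 1 := by
  intro s hs
  exact ⟨hs.1, fun a => (Finset.single_le_sum (fun b _ => hs.1 b) (Finset.mem_univ a)).trans hs.2⟩

theorem isCompact_refSimplex (n : ℕ) : IsCompact (refSimplex n) := by
  refine isCompact_Icc.of_isClosed_subset ?_ (refSimplex_subset_Icc n)
  have h1 : IsClosed {s : Fin n → ℝ | ∀ a, 0 ≤ s a} := by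
    simp only [ofPred_forall]
    exact isClosed_iInter fun a => isClosed_le continuous_const (continuous_apply a)
  have h2 : IsClosed {s : Fin n → ℝ | ∑ a, s a ≤ 1} :=
    isClosed_le (by fun_prop) continuous_const
  exact h1.inter h2

theorem refSimplex_volume_pos (n : ℕ) : 0 < ∫ _ in refSimplex n, (1 : ℝ) := by
  have hfin : volume (refSimplex n) ≠ ⊤ := (isCompact_refSimplex n).measure_lt_top.ne
  rw [setIntegral_const, smul_eq_mul, mul_one, Measure.real, ENNReal.toReal_pos_iff]
  refine ⟨?_, lt_top_iff_ne_top.2 hfin⟩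
  -- An open cube of side 1/(n+1) fits into the simplex, since its coordinate sums stay below
  -- n/(n+1).
  have hsub : (Set.pi univ fun _ : Fin n => Ioo (0 : ℝ) (1 / (n + 1))) ⊆ refSimplex n := by
    intro s hs
    have hs' : ∀ a, s a ∈ Ioo (0 : ℝ) (1 / (n + 1)) := fun a => hs a (mem_univ a)
    refine ⟨fun a => (hs' a).1.le, ?_⟩
    calc ∑ a, s a ≤ ∑ _a : Fin n, (1 / ((n : ℝ) + 1)) := Finset.sum_le_sum fun a _ => (hs' a).2.le
      _ = n / (n + 1) := by simp; ring
      _ ≤ 1 := by rw [div_le_one (by positivity)]; linarith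
  refine lt_of_lt_of_le ?_ (measure_mono hsub)
  refine IsOpen.measure_pos _ (isOpen_set_pi finite_univ fun _ _ => isOpen_Ioo) ?_
  exact ⟨fun _ => 1 / (2 * ((n : ℝ) + 1)), fun a _ => ⟨by positivity, by
    rw [one_div_lt_one_div (by positivity) (by positivity)]
    linarith [show (0 : ℝ) ≤ n from n.cast_nonneg]⟩⟩

theorem area_pos {n : ℕ} {v : Fin (n + 1) → E n} (hv : AffineIndependent ℝ v) : 0 < area v :=
  mul_pos (Real.sqrt_pos.2 (gramMat_det_pos hv)) (refSimplex_volume_pos n)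

/-- The affine involution of the parameter domain that interchanges vertices `0` and `a + 1`. -/
def swapParam {n : ℕ} (a : Fin n) (s : Fin n → ℝ) : Fin n → ℝ :=
  Function.update s a (1 - ∑ b, s b)

theorem sum_swapParam {n : ℕ} (a : Fin n) (s : Fin n → ℝ) :
    ∑ b, swapParam a s b = 1 - s a := by
  rw [swapParam, Finset.sum_update_of_mem (Finset.mem_univ a),
    ← Finset.add_sum_erase _ s (Finset.mem_univ a), Finset.sdiff_singleton_eq_erase]
  ring

theorem swapParam_involutive {n : ℕ} (a : Fin n) : Function.Involutive (swapParam a) := by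
  intro s
  ext b
  by_cases h : b = a
  · subst h
    rw [swapParam, Function.update_self, sum_swapParam]; ring
  · simp [swapParam, h]

/-- The map is a linear involution L followed by a translation. From L² = id the determinant is ±1,
so volume is preserved. -/
theorem measurePreserving_swapParam {n : ℕ} (a : Fin n) :
    MeasurePreserving (swapParam a) volume volume := by
  let L : (Fin n → ℝ) →ₗ[ℝ] (Fin n → ℝ) :=
    { toFun := fun s => Function.update s a (-∑ b, s b)
      map_add' := fun s r => by
        ext b
        by_cases h : b = a
        · subst h; simp [Finset.sum_add_distrib]; ring
        · simp [h]
      map_smul' := fun c s => by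
        ext b
        by_cases h : b = a
        · subst h; simp [Finset.mul_sum]
        · simp [h] }
  have hsum : ∀ s, ∑ b, L s b = - s a := fun s => by
    change ∑ b, Function.update s a (-∑ b, s b) b = _
    rw [Finset.sum_update_of_mem (Finset.mem_univ a),
      ← Finset.add_sum_erase _ s (Finset.mem_univ a), Finset.sdiff_singleton_eq_erase]
    ring
  have hLL : L ∘ₗ L = LinearMap.id := by
    refine LinearMap.ext fun s => funext fun b => ?_
    change Function.update (L s) a (-∑ b, L s b) b = s b
    by_cases h : b = a
    · subst h; simp [hsum]
    · rw [Function.update_of_ne h]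
      change Function.update s a _ b = s b
      rw [Function.update_of_ne h]
  have hdet : LinearMap.det L * LinearMap.det L = 1 := by
    rw [← LinearMap.det_comp, hLL, LinearMap.det_id]
  have hne : LinearMap.det L ≠ 0 := fun h => by simp [h] at hdet
  have habs : |(LinearMap.det L)⁻¹| = 1 := by
    rcases mul_self_eq_one_iff.1 hdet with h | h <;> simp [h]
  have h1 : MeasurePreserving L volume volume :=
    ⟨L.continuous_of_finiteDimensional.measurable, by
      rw [Measure.map_linearMap_addHaar_eq_smul_addHaar volume hne, habs]; simp⟩
  have h2 := (measurePreserving_add_right volume (Pi.single a (1 : ℝ))).comp h1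
  convert h2 using 1
  ext s b
  change Function.update s a (1 - ∑ b, s b) b =
    Function.update s a (-∑ b, s b) b + (Pi.single a (1 : ℝ) : Fin n → ℝ) b
  by_cases h : b = a
  · subst h; simp; ring
  · simp [h]

theorem swapParam_mem {n : ℕ} (a : Fin n) {s : Fin n → ℝ} (hs : s ∈ refSimplex n) :
    swapParam a s ∈ refSimplex n := by
  refine ⟨fun b => ?_, by rw [sum_swapParam]; linarith [hs.1 a]⟩
  by_cases h : b = a
  · subst h; simp [swapParam, hs.2]
  · simp [swapParam, h, hs.1 b]

theorem sum_bary {n : ℕ} (s : Fin n → ℝ) : ∑ i, bary s i = 1 := by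
  simp [Fin.sum_univ_succ, bary]

theorem continuous_bary {n : ℕ} (i : Fin (n + 1)) : Continuous fun s : Fin n → ℝ => bary s i := by
  refine Fin.cases ?_ (fun a => ?_) i
  · simp only [bary, Fin.cons_zero]; fun_prop
  · simp only [bary, Fin.cons_succ]; fun_prop

/-- The swap preserves both volume and the simplex while exchanging two barycentric coordinates. As
the coordinates sum to 1, each has mean 1/(n+1). -/
theorem setIntegral_bary_eq {n : ℕ} (i : Fin (n + 1)) :
    ∫ s in refSimplex n, bary s i = ∫ s in refSimplex n, bary s 0 := by
  refine Fin.cases rfl (fun a => ?_) i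
  have hpre : swapParam a ⁻¹' refSimplex n = refSimplex n := by
    ext s
    refine ⟨fun h => ?_, fun h => swapParam_mem a h⟩
    have := swapParam_mem a h
    rwa [swapParam_involutive a s] at this
  have hmeas : Measurable (swapParam a) := (measurePreserving_swapParam a).measurable
  let e : (Fin n → ℝ) ≃ᵐ (Fin n → ℝ) :=
    { toEquiv := (swapParam_involutive a).toPerm
      measurable_toFun := hmeas
      measurable_invFun := hmeas }
  have h := (measurePreserving_swapParam a).setIntegral_preimage_emb
    (e.measurableEmbedding) (fun s => bary s 0) (refSimplex n)
  rw [hpre] at h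
  rw [← h]
  refine integral_congr_ae (Eventually.of_forall fun s => ?_)
  change bary s a.succ = bary (swapParam a s) 0
  simp [bary, sum_swapParam]

theorem setIntegral_bary {n : ℕ} (i : Fin (n + 1)) :
    ∫ s in refSimplex n, bary s i = 1 / ((n : ℝ) + 1) * ∫ _ in refSimplex n, (1 : ℝ) := by
  have hint : ∀ i, IntegrableOn (fun s : Fin n → ℝ => bary s i) (refSimplex n) := fun i =>
    (continuous_bary i).continuousOn.integrableOn_compact (isCompact_refSimplex n)
  have h : ∫ _ in refSimplex n, (1 : ℝ) = ∑ i, ∫ s in refSimplex n, bary s i := by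
    rw [← integral_finsetSum _ fun i _ => hint i]
    simp_rw [sum_bary]
  rw [h]
  simp_rw [setIntegral_bary_eq]
  simp
  field_simp

/-- The vertex quadrature rule is exact for affine functions. -/
theorem elemIntegral_affine {n : ℕ} (v : Fin (n + 1) → E n) (z : Fin (n + 1) → ℝ) :
    elemIntegral v (fun w => ∑ i, w i * z i) = 1 / ((n : ℝ) + 1) * (area v * ∑ i, z i) := by
  have hint : ∀ i, IntegrableOn (fun s : Fin n → ℝ => bary s i * z i) (refSimplex n) := fun i =>
    ((continuous_bary i).mul continuous_const).continuousOn.integrableOn_compact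
      (isCompact_refSimplex n)
  rw [elemIntegral, integral_finsetSum _ fun i _ => hint i]
  simp_rw [integral_mul_const, setIntegral_bary, area, elemIntegral, ← Finset.mul_sum]
  ring

theorem surfInt_feVal {n K J : ℕ} (σ : Fin J → Fin (n + 1) → Fin K) (q : Fin K → E n)
    (z : Fin K → ℝ) :
    surfInt σ q (fun j w => feVal σ z j w) = lump σ q fun j i => z (σ j i) := by
  simp only [surfInt, feVal, lump, Finset.mul_sum]
  exact Finset.sum_congr rfl fun j _ => by
    rw [elemIntegral_affine]; simp only [Finset.mul_sum]

/-! ### Dependence on the vertices -/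

theorem continuous_gramMat {n : ℕ} : Continuous fun v : Fin (n + 1) → E n => gramMat v := by
  refine continuous_matrix fun a b => ?_
  simp only [gramMat, edge, Matrix.of_apply]
  fun_prop

theorem area_eq_sqrt_mul {n : ℕ} (v : Fin (n + 1) → E n) :
    area v = Real.sqrt (gramMat v).det * ∫ _ in refSimplex n, (1 : ℝ) := rfl

theorem continuous_area {n : ℕ} : Continuous fun v : Fin (n + 1) → E n => area v := by
  simp only [area_eq_sqrt_mul]
  exact (continuous_gramMat.matrix_det.sqrt).mul continuous_const

/-- The area is a constant times the square root of a polynomial in the vertices; nondegeneracy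
keeps the radicand away from 0. -/
theorem differentiableWithinAt_area {n : ℕ} {v : ℝ → Fin (n + 1) → E n} {A : Set ℝ} {t : ℝ}
    (hv : ∀ i, DifferentiableWithinAt ℝ (fun s => v s i) A t)
    (ht : AffineIndependent ℝ (v t)) :
    DifferentiableWithinAt ℝ (fun s => area (v s)) A t := by
  have hg : ∀ a b, DifferentiableWithinAt ℝ (fun s => gramMat (v s) a b) A t := fun a b =>
    ((hv _).fun_sub (hv _)).inner ℝ ((hv _).fun_sub (hv _))
  have hdet : DifferentiableWithinAt ℝ (fun s => (gramMat (v s)).det) A t := by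
    simp only [Matrix.det_apply]
    refine DifferentiableWithinAt.fun_sum fun τ _ => DifferentiableWithinAt.const_smul ?_ _
    exact DifferentiableWithinAt.fun_finsetProd fun a _ => hg _ _
  simp only [area_eq_sqrt_mul]
  exact (hdet.sqrt (gramMat_det_pos ht).ne').mul_const _

theorem continuousAt_gradS {n : ℕ} {v : Fin (n + 1) → E n} (hv : AffineIndependent ℝ v)
    (f : Fin (n + 1) → ℝ) :
    ContinuousAt (fun p : (Fin (n + 1) → E n) × (Fin (n + 1) → ℝ) => gradS p.1 p.2) (v, f) := by
  have hinv : ∀ a b, ContinuousAt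
      (fun p : (Fin (n + 1) → E n) × (Fin (n + 1) → ℝ) => (gramMat p.1)⁻¹ a b) (v, f) := by
    intro a b
    have hd : ContinuousAt (fun p : (Fin (n + 1) → E n) × (Fin (n + 1) → ℝ) =>
        ((gramMat p.1).det)⁻¹) (v, f) :=
      ((continuous_gramMat.matrix_det.comp continuous_fst).continuousAt).inv₀
        (gramMat_det_pos hv).ne'
    have ha : Continuous fun p : (Fin (n + 1) → E n) × (Fin (n + 1) → ℝ) =>
        (gramMat p.1).adjugate a b :=
      ((continuous_gramMat.comp continuous_fst).matrix_adjugate).matrix_elem a b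
    -- The inverse is the adjugate, a polynomial in the entries, divided by the nonzero determinant.
    simp only [Matrix.inv_def, Ring.inverse_eq_inv', Matrix.smul_apply, smul_eq_mul]
    exact hd.mul ha.continuousAt
  unfold gradS
  refine tendsto_finsetSum _ fun a _ => tendsto_finsetSum _ fun b _ => ?_
  refine ContinuousAt.smul ((hinv a b).mul ?_) ?_
  · exact (by fun_prop : Continuous fun p : (Fin (n + 1) → E n) × (Fin (n + 1) → ℝ) =>
      p.2 b.succ - p.2 0).continuousAt
  · exact (by unfold edge; fun_prop : Continuous fun p : (Fin (n + 1) → E n) × (Fin (n + 1) → ℝ) =>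
      edge p.1 a).continuousAt

theorem gradS_sum_smul {n : ℕ} {ι : Type*} (s : Finset ι) (v : Fin (n + 1) → E n) (c : ι → ℝ)
    (f : ι → Fin (n + 1) → ℝ) :
    gradS v (fun i => ∑ l ∈ s, c l * f l i) = ∑ l ∈ s, c l • gradS v (f l) := by
  simp only [gradS, Finset.smul_sum, smul_smul]
  rw [Finset.sum_comm (s := s)]
  refine Finset.sum_congr rfl fun a _ => ?_
  rw [Finset.sum_comm (s := s)]
  refine Finset.sum_congr rfl fun b _ => ?_
  rw [← Finset.sum_smul, ← Finset.sum_sub_distrib, Finset.mul_sum]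
  congr 1
  exact Finset.sum_congr rfl fun l _ => by ring

theorem gradS_const {n : ℕ} (v : Fin (n + 1) → E n) (c : ℝ) : gradS v (fun _ => c) = 0 := by
  simp [gradS]

/-! ### Forms on the polyhedral surface -/

section Forms

variable {n K J : ℕ} {σ : Fin J → Fin (n + 1) → Fin K}

theorem diffForm_eq_sum_area (q : Fin K → E n) (ψ χ : Fin K → ℝ) :
    diffForm σ q ψ χ = ∑ j, area (loc σ q j) *
      inner ℝ (gradS (loc σ q j) (loc σ ψ j)) (gradS (loc σ q j) (loc σ χ j)) := by
  simp only [diffForm, surfInt, elemIntegral_const]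

theorem diffForm_const_right (q : Fin K → E n) (ψ : Fin K → ℝ) (c : ℝ) :
    diffForm σ q ψ (fun _ => c) = 0 := by
  rw [diffForm_eq_sum_area]
  refine Finset.sum_eq_zero fun j _ => ?_
  rw [show loc σ (fun _ : Fin K => c) j = fun _ => c from rfl, gradS_const]
  simp

theorem diffForm_eq_sum_single (q : Fin K → E n) (ψ χ : Fin K → ℝ) :
    diffForm σ q ψ χ = ∑ l, ψ l * diffForm σ q (Pi.single l 1) χ := by
  simp only [diffForm_eq_sum_area, Finset.mul_sum]
  rw [Finset.sum_comm]
  refine Finset.sum_congr rfl fun j _ => ?_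
  have h : loc σ ψ j = fun i => ∑ l, ψ l * loc σ (Pi.single l (1 : ℝ)) j i := by
    ext i
    simp [loc, Pi.single_apply]
  rw [h, gradS_sum_smul, sum_inner, Finset.mul_sum]
  refine Finset.sum_congr rfl fun l _ => ?_
  rw [real_inner_smul_left]
  ring

theorem continuousOn_diffForm {q : ℝ → Fin K → E n} {ψ χ : ℝ → Fin K → ℝ} {A : Set ℝ}
    (hnd : ∀ t ∈ A, ∀ j, AffineIndependent ℝ (loc σ (q t) j))
    (hq : ∀ k, ContinuousOn (fun t => q t k) A) (hψ : ∀ k, ContinuousOn (fun t => ψ t k) A)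
    (hχ : ∀ k, ContinuousOn (fun t => χ t k) A) :
    ContinuousOn (fun t => diffForm σ (q t) (ψ t) (χ t)) A := by
  intro t ht
  simp only [diffForm_eq_sum_area]
  have hloc : ∀ j, ContinuousWithinAt (fun s => loc σ (q s) j) A t := fun j =>
    continuousWithinAt_pi.2 fun i => hq _ t ht
  have hgrad : ∀ {φ : ℝ → Fin K → ℝ}, (∀ k, ContinuousOn (fun t => φ t k) A) → ∀ j,
      ContinuousWithinAt (fun s => gradS (loc σ (q s) j) (loc σ (φ s) j)) A t := fun hφ j =>
    (continuousAt_gradS (hnd t ht j) _).comp_continuousWithinAt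
      (f := fun s => (loc σ (q s) j, loc σ (_ : Fin K → ℝ) j))
      ((hloc j).prodMk (continuousWithinAt_pi.2 fun i => hφ _ t ht))
  exact tendsto_finsetSum _ fun j _ =>
    ((continuous_area.continuousAt.comp_continuousWithinAt (hloc j))).mul
      ((hgrad hψ j).inner (𝕜 := ℝ) (hgrad hχ j))

/-- The lumped mass of the vertex `k`. -/
noncomputable def nodeMass (σ : Fin J → Fin (n + 1) → Fin K) (q : Fin K → E n) (k : Fin K) : ℝ :=
  lump σ q fun j i => (Pi.single k (1 : ℝ) : Fin K → ℝ) (σ j i)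

/-- Lumping makes the mass matrix diagonal, so testing with a hat function isolates a single nodal
amount. -/
theorem lump_mul_single (q : Fin K → E n) (z : Fin K → ℝ) (k : Fin K) :
    (lump σ q fun j i => z (σ j i) * (Pi.single k (1 : ℝ) : Fin K → ℝ) (σ j i)) =
      nodeMass σ q k * z k := by
  have h : ∀ l, z l * (Pi.single k (1 : ℝ) : Fin K → ℝ) l =
      (Pi.single k (1 : ℝ) : Fin K → ℝ) l * z k := by
    intro l
    by_cases h : l = k
    · subst h; ring
    · simp [h]
  simp only [h, nodeMass, lump, ← Finset.sum_mul, ← mul_assoc]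

theorem nodeMass_pos {q : Fin K → E n} (h : IsPolyhedral σ q) (k : Fin K) :
    0 < nodeMass σ q k := by
  obtain ⟨j, i, rfl⟩ := h.vertex_used k
  have h0 : ∀ l, 0 ≤ (Pi.single (σ j i) (1 : ℝ) : Fin K → ℝ) l := fun l => by
    by_cases hl : l = σ j i
    · subst hl; simp
    · simp [hl]
  refine mul_pos (by positivity) (Finset.sum_pos' (fun j' _ => mul_nonneg
    (area_pos (h.nondegenerate j')).le (Finset.sum_nonneg fun i' _ => h0 _))
    ⟨j, Finset.mem_univ _, mul_pos (area_pos (h.nondegenerate j))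
      (Finset.sum_pos' (fun i' _ => h0 _) ⟨i, Finset.mem_univ _, by simp⟩)⟩)

theorem continuousOn_nodeMass {q : ℝ → Fin K → E n} {A : Set ℝ}
    (hq : ∀ k, ContinuousOn (fun t => q t k) A) (k : Fin K) :
    ContinuousOn (fun t => nodeMass σ (q t) k) A := by
  intro t ht
  have hloc : ∀ j, ContinuousWithinAt (fun s => loc σ (q s) j) A t := fun j =>
    continuousWithinAt_pi.2 fun i => hq _ t ht
  exact continuousWithinAt_const.mul (tendsto_finsetSum _ fun j _ =>
    ((continuous_area.continuousAt.comp_continuousWithinAt (hloc j))).mul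
      continuousWithinAt_const)

theorem differentiableWithinAt_lump {q : ℝ → Fin K → E n} {g : ℝ → Fin J → Fin (n + 1) → ℝ}
    {A : Set ℝ} {t : ℝ} (hnd : ∀ j, AffineIndependent ℝ (loc σ (q t) j))
    (hq : ∀ k, DifferentiableWithinAt ℝ (fun t => q t k) A t)
    (hg : ∀ j i, DifferentiableWithinAt ℝ (fun t => g t j i) A t) :
    DifferentiableWithinAt ℝ (fun s => lump σ (q s) (g s)) A t := by
  refine DifferentiableWithinAt.const_mul (DifferentiableWithinAt.fun_sum fun j _ => ?_) _
  exact (differentiableWithinAt_area (v := fun s => loc σ (q s) j) (fun i => hq _) (hnd j)).fun_mul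
    (DifferentiableWithinAt.fun_sum fun i _ => hg j i)

end Forms

/-! ### Surfactant transport -/

section Surfactant

variable {n N K J : ℕ} {Ω : Set (E n)} {T : ℝ} {mesh : Fin N → BulkSimplex n}
  {Uh : Submodule ℝ (CBar Ω)} {Ph : ℝ → Submodule ℝ (Pressure Ω)} {ph : Phys n}
  {f₁ f₂ : ℝ → CBar Ω} {σ : Fin J → Fin (n + 1) → Fin K} {S : Fields n K Ω}

theorem IsSolution.Psi_diff (hS : IsSolution T mesh Uh Ph ph f₁ f₂ σ S) (k : Fin K) :
    DifferentiableOn ℝ (fun t => S.Psi t k) (Icc 0 T) :=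
  (hS.Psi_mem k).differentiableOn one_ne_zero

/-- For time independent nodal values the surfactant equation holds at every time. -/
theorem IsSolution.surfactant_everywhere (hS : IsSolution T mesh Uh Ph ph f₁ f₂ σ S)
    (χ : Fin K → ℝ) : ∀ t ∈ Icc 0 T, HasDerivWithinAt
      (fun s => lump σ (S.q s) fun j i => S.Psi s (σ j i) * χ (σ j i))
      (-(ph.DG * diffForm σ (S.q t) (S.Psi t) χ)) (Icc 0 T) t := by
  refine hasDerivWithinAt_of_ae_eq
    (f' := derivWithin (fun s => lump σ (S.q s) fun j i => S.Psi s (σ j i) * χ (σ j i)) (Icc 0 T))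
    (fun t ht => (differentiableWithinAt_lump (hS.polyhedral t ht).nondegenerate
      (fun k => hS.q_diff k t ht) fun j i =>
        (hS.Psi_diff _ t ht).mul_const _).hasDerivWithinAt) ?_ ?_
  · refine (continuousOn_const.mul (continuousOn_diffForm (χ := fun _ => χ)
      (fun t ht => (hS.polyhedral t ht).nondegenerate) (fun k => (hS.q_diff k).continuousOn)
      (fun k => (hS.Psi_diff k).continuousOn) fun k => continuousOn_const)).neg
  · filter_upwards [hS.surfactant (fun _ => χ) (fun k => contDiffOn_const),
      ae_restrict_mem measurableSet_Ioo] with t ht htm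
    obtain ⟨a, ha, hea⟩ := ht
    have hT : 0 < T := htm.1.trans htm.2
    rw [ha.hasDerivWithinAt.derivWithin (uniqueDiffOn_Icc hT t (Ioo_subset_Icc_self htm))]
    simp only [dt, derivWithin_fun_const, Pi.zero_apply, mul_zero] at hea
    have h0 : (lump σ (S.q t) fun _ _ => (0 : ℝ)) = 0 := by simp [lump]
    rw [h0] at hea
    linarith

theorem IsSolution.totalSurfactant_conserved (hS : IsSolution T mesh Uh Ph ph f₁ f₂ σ S) :
    ∀ t ∈ Icc 0 T, HasDerivWithinAt (totalSurfactant σ S) 0 (Icc 0 T) t := by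
  intro t ht
  have h := hS.surfactant_everywhere (fun _ => 1) t ht
  rw [diffForm_const_right, mul_zero, neg_zero] at h
  have he : totalSurfactant σ S = fun s => lump σ (S.q s) fun j i => S.Psi s (σ j i) * 1 := by
    ext s
    simp [totalSurfactant, surfInt_feVal]
  rw [he]
  exact h

/-- The system of ordinary differential equations for the nodal amounts `m_k Ψ_k`. -/
theorem IsSolution.nodal_ode (hS : IsSolution T mesh Uh Ph ph f₁ f₂ σ S) (k : Fin K) :
    ∀ t ∈ Icc 0 T, HasDerivWithinAt (fun s => nodeMass σ (S.q s) k * S.Psi s k)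
      (∑ l, -(ph.DG * diffForm σ (S.q t) (Pi.single l 1) (Pi.single k 1) /
        nodeMass σ (S.q t) l) * (nodeMass σ (S.q t) l * S.Psi t l)) (Icc 0 T) t := by
  intro t ht
  have h := hS.surfactant_everywhere (Pi.single k 1) t ht
  simp only [lump_mul_single] at h
  refine h.congr_deriv ?_
  rw [diffForm_eq_sum_single, Finset.mul_sum, ← Finset.sum_neg_distrib]
  refine Finset.sum_congr rfl fun l _ => ?_
  have := (nodeMass_pos (hS.polyhedral t ht) l).ne'
  field_simp

/-- With m_k Ψ_k as unknowns, the coefficients involve the vertex positions but not their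
velocities. They are thus continuous on a compact interval. -/
theorem IsSolution.exists_coeff_bound (hS : IsSolution T mesh Uh Ph ph f₁ f₂ σ S) :
    ∃ C : ℝ, ∀ t ∈ Icc 0 T, ∀ k l,
      |-(ph.DG * diffForm σ (S.q t) (Pi.single l 1) (Pi.single k 1) /
        nodeMass σ (S.q t) l)| ≤ C := by
  have hc : ∀ k l, ContinuousOn (fun t => |-(ph.DG *
      diffForm σ (S.q t) (Pi.single l 1) (Pi.single k 1) / nodeMass σ (S.q t) l)|) (Icc 0 T) := by
    intro k l
    have hq : ∀ k, ContinuousOn (fun t => S.q t k) (Icc 0 T) := fun k => (hS.q_diff k).continuousOn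
    exact (((continuousOn_const.mul (continuousOn_diffForm (ψ := fun _ => Pi.single l 1)
      (χ := fun _ => Pi.single k 1) (fun t ht => (hS.polyhedral t ht).nondegenerate) hq
      (fun _ => continuousOn_const) fun _ => continuousOn_const)).div (continuousOn_nodeMass hq l)
      fun t ht => (nodeMass_pos (hS.polyhedral t ht) l).ne').neg).abs
  have hb : ∀ k l, ∃ C : ℝ, ∀ t ∈ Icc 0 T, |-(ph.DG *
      diffForm σ (S.q t) (Pi.single l 1) (Pi.single k 1) / nodeMass σ (S.q t) l)| ≤ C :=
    fun k l => (isCompact_Icc.bddAbove_image (hc k l)).imp fun C hC t ht =>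
      hC (mem_image_of_mem _ ht)
  choose C hC using hb
  refine ⟨∑ k, ∑ l, |C k l|, fun t ht k l => ?_⟩
  calc _ ≤ |C k l| := (hC k l t ht).trans (le_abs_self _)
    _ ≤ ∑ l, |C k l| := Finset.single_le_sum (fun l _ => abs_nonneg (C k l)) (Finset.mem_univ l)
    _ ≤ ∑ k, ∑ l, |C k l| := Finset.single_le_sum (f := fun k => ∑ l, |C k l|)
        (fun k _ => Finset.sum_nonneg fun l _ => abs_nonneg (C k l)) (Finset.mem_univ k)

theorem IsSolution.psiNonneg_iff (hS : IsSolution T mesh Uh Ph ph f₁ f₂ σ S) {t : ℝ}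
    (ht : t ∈ Icc 0 T) : PsiNonneg σ S t ↔ ∀ k, 0 ≤ S.Psi t k := by
  refine ⟨fun h k => ?_, fun h j w hw => Finset.sum_nonneg fun i _ => mul_nonneg (hw.1 i) (h _)⟩
  obtain ⟨j, i, rfl⟩ := (hS.polyhedral t ht).vertex_used k
  simpa [feVal, Pi.single_apply] using h j (Pi.single i 1) (single_mem_stdSimplex ℝ i)

theorem IsSolution.psiBelow_vertex (hS : IsSolution T mesh Uh Ph ph f₁ f₂ σ S) {t : ℝ}
    (ht : t ∈ Icc 0 T) (h : PsiBelow ph σ S t) (k : Fin K) : (S.Psi t k : EReal) < ph.psiInf := by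
  obtain ⟨j, i, rfl⟩ := (hS.polyhedral t ht).vertex_used k
  simpa [feVal, Pi.single_apply] using h j (Pi.single i 1) (single_mem_stdSimplex ℝ i)

theorem NonObtuse.diffForm_nonpos (h : NonObtuse T σ S) {t : ℝ} (ht : t ∈ Icc 0 T) {i k : Fin K}
    (hik : i ≠ k) : diffForm σ (S.q t) (Pi.single i 1) (Pi.single k 1) ≤ 0 := by
  unfold diffForm surfInt
  exact Finset.sum_nonpos fun j _ => h t ht j i k hik

theorem IsSolution.coeff_nonneg (hS : IsSolution T mesh Uh Ph ph f₁ f₂ σ S)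
    (h : ph.DG = 0 ∨ NonObtuse T σ S) {t : ℝ} (ht : t ∈ Icc 0 T) {k l : Fin K} (hkl : k ≠ l) :
    0 ≤ -(ph.DG * diffForm σ (S.q t) (Pi.single l 1) (Pi.single k 1) /
      nodeMass σ (S.q t) l) := by
  rw [neg_nonneg]
  refine div_nonpos_of_nonpos_of_nonneg ?_ (nodeMass_pos (hS.polyhedral t ht) l).le
  rcases h with h | h
  · simp [h]
  · exact mul_nonpos_of_nonneg_of_nonpos ph.DG_nonneg (h.diffForm_nonpos ht hkl.symm)

theorem IsSolution.psiNonneg (hS : IsSolution T mesh Uh Ph ph f₁ f₂ σ S)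
    (h : ph.DG = 0 ∨ NonObtuse T σ S) (hT : 0 < T) (h0 : PsiNonneg σ S 0) :
    ∀ t ∈ Ioc 0 T, PsiNonneg σ S t := by
  intro t ht
  have ht' := Ioc_subset_Icc_self ht
  have h00 : (0 : ℝ) ∈ Icc 0 T := ⟨le_rfl, hT.le⟩
  obtain ⟨C, hC⟩ := hS.exists_coeff_bound
  have hy := nonneg_of_quasipositive (y := fun s k => nodeMass σ (S.q s) k * S.Psi s k)
    (fun t ht k => hS.nodal_ode k t ht) (fun t ht k l hkl => hS.coeff_nonneg h ht hkl) hC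
    (fun k => mul_nonneg (nodeMass_pos (hS.polyhedral 0 h00) k).le ((hS.psiNonneg_iff h00).1 h0 k))
  exact (hS.psiNonneg_iff ht').2 fun k =>
    nonneg_of_mul_nonneg_right (hy t ht' k) (nodeMass_pos (hS.polyhedral t ht') k)

/-- For a nonnegative concentration, once positive at a vertex, always positive there. -/
theorem IsSolution.Psi_eq_zero_of_le (hS : IsSolution T mesh Uh Ph ph f₁ f₂ σ S)
    (h : ph.DG = 0 ∨ NonObtuse T σ S) (hn : ∀ t ∈ Icc 0 T, PsiNonneg σ S t) {k : Fin K} {s t : ℝ}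
    (hs : 0 ≤ s) (hst : s ≤ t) (ht : t ≤ T) (hz : S.Psi t k = 0) : S.Psi s k = 0 := by
  obtain ⟨C, hC⟩ := hS.exists_coeff_bound
  have hnn : ∀ t ∈ Icc 0 T, ∀ l, 0 ≤ nodeMass σ (S.q t) l * S.Psi t l := fun t ht l =>
    mul_nonneg (nodeMass_pos (hS.polyhedral t ht) l).le ((hS.psiNonneg_iff ht).1 (hn t ht) l)
  have hm := monotoneOn_exp_mul (C := C) (hS.nodal_ode k) (fun t ht => by
    rw [← Finset.add_sum_erase _ _ (Finset.mem_univ k)]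
    have h1 := Finset.sum_nonneg (s := Finset.univ.erase k) (f := fun l =>
      -(ph.DG * diffForm σ (S.q t) (Pi.single l 1) (Pi.single k 1) /
        nodeMass σ (S.q t) l) * (nodeMass σ (S.q t) l * S.Psi t l)) (fun l hl =>
      mul_nonneg (hS.coeff_nonneg h ht (Finset.ne_of_mem_erase hl).symm) (hnn t ht l))
    -- The off-diagonal contributions are nonnegative, so only the diagonal entry can decrease y_k,
    -- at a rate of at most C y_k.
    have h2 := mul_le_mul_of_nonneg_right (neg_le_of_abs_le (hC t ht k k)) (hnn t ht k)
    linarith)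
  have hsm : s ∈ Icc 0 T := ⟨hs, hst.trans ht⟩
  have h3 := hm hsm ⟨hs.trans hst, ht⟩ hst
  simp only [hz, mul_zero] at h3
  have hmp := nodeMass_pos (hS.polyhedral s hsm) k
  have h4 : S.Psi s k ≤ 0 := by
    by_contra hcon
    push Not at hcon
    exact absurd h3 (not_le.2 (mul_pos (Real.exp_pos _) (mul_pos hmp hcon)))
  exact le_antisymm h4 ((hS.psiNonneg_iff hsm).1 (hn s hsm) k)

end Surfactant

/-! ### Surface energy density -/

/-- F is not assumed twice differentiable. Writing F' = (F - γ)/r makes F' differentiable, and the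
quotient rule gives the derivative -γ'/r ≥ 0. -/
theorem Phys.deriv_F_monotoneOn {n : ℕ} (ph : Phys n) :
    MonotoneOn (deriv ph.F) {r : ℝ | 0 < r ∧ (r : EReal) < ph.psiInf} := by
  set D : Set ℝ := {r : ℝ | 0 < r ∧ (r : EReal) < ph.psiInf} with hD
  have hopen : IsOpen D :=
    (isOpen_lt continuous_const continuous_id).inter
      (isOpen_lt continuous_coe_real_ereal continuous_const)
  have hconv : Convex ℝ D := by
    refine OrdConnected.convex ⟨fun a ha b hb c hc => ⟨ha.1.trans_le hc.1, ?_⟩⟩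
    exact (EReal.coe_le_coe_iff.2 hc.2).trans_lt hb.2
  have heq : ∀ r ∈ D, deriv ph.F r = (ph.F r - ph.γ r) / r := by
    intro r hr
    have := ph.F_eq r hr.1 hr.2
    have h0 := hr.1.ne'
    field_simp
    linarith
  have hder : ∀ r ∈ D, HasDerivAt (fun r => (ph.F r - ph.γ r) / r)
      (-(derivWithin ph.γ {r : ℝ | 0 ≤ r ∧ (r : EReal) < ph.psiInf} r) / r) r := by
    intro r hr
    have hr0 : r ≠ 0 := hr.1.ne'
    have hnhds : {r : ℝ | 0 ≤ r ∧ (r : EReal) < ph.psiInf} ∈ 𝓝 r :=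
      mem_of_superset (hopen.mem_nhds hr) fun s hs => ⟨hs.1.le, hs.2⟩
    have hγ := ((ph.γ_smooth.differentiableOn one_ne_zero r
      ⟨hr.1.le, hr.2⟩).hasDerivWithinAt).hasDerivAt hnhds
    have hF := (ph.F_diff r hr.1 hr.2).hasDerivAt
    refine ((hF.fun_sub hγ).fun_div (hasDerivAt_id' r) hr0).congr_deriv ?_
    rw [heq r hr]
    field_simp
    ring
  have hmono : MonotoneOn (fun r => (ph.F r - ph.γ r) / r) D :=
    monotoneOn_of_hasDerivWithinAt_nonneg hconv
      (fun r hr => (hder r hr).continuousAt.continuousWithinAt)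
      (fun r hr => (hder r (interior_subset hr)).hasDerivWithinAt) fun r hr => by
        have hr' := interior_subset hr
        exact div_nonneg (neg_nonneg.2 (ph.γ_mono r hr'.1.le hr'.2)) hr'.1.le
  exact hmono.congr fun r hr => (heq r hr).symm

/-- Nodal slopes of the energy density, with an arbitrary small value where `F'` may be
infinite. -/
theorem Phys.exists_slopes {n K : ℕ} (ph : Phys n) {ψ : Fin K → ℝ}
    (h1 : ∀ k, (ψ k : EReal) < ph.psiInf) :
    ∃ g : Fin K → ℝ, (∀ k, 0 < ψ k → g k = deriv ph.F (ψ k)) ∧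
      ∀ k l, 0 ≤ (ψ k - ψ l) * (g k - g l) := by
  classical
  -- The value at nonpositive ψ_k lies below every slope occurring at a vertex, so g keeps the order
  -- of ψ.
  set g : Fin K → ℝ := fun k => if 0 < ψ k then deriv ph.F (ψ k) else -∑ l, |deriv ph.F (ψ l)|
    with hg
  have hmono : ∀ k l, ψ k ≤ ψ l → g k ≤ g l := by
    intro k l hkl
    by_cases hk : 0 < ψ k
    · have hl : 0 < ψ l := hk.trans_le hkl
      simp only [hg, if_pos hk, if_pos hl]
      exact ph.deriv_F_monotoneOn ⟨hk, h1 k⟩ ⟨hl, h1 l⟩ hkl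
    · by_cases hl : 0 < ψ l
      · simp only [hg, if_neg hk, if_pos hl]
        have h2 := Finset.single_le_sum (f := fun l => |deriv ph.F (ψ l)|)
          (fun l _ => abs_nonneg _) (Finset.mem_univ l)
        linarith [neg_abs_le (deriv ph.F (ψ l))]
      · simp only [hg, if_neg hk, if_neg hl, le_refl]
  refine ⟨g, fun k hk => by simp [hg, hk], fun k l => ?_⟩
  rcases le_total (ψ k) (ψ l) with h | h
  · exact mul_nonneg_of_nonpos_of_nonpos (sub_nonpos.2 h) (sub_nonpos.2 (hmono k l h))
  · exact mul_nonneg (sub_nonneg.2 h) (sub_nonneg.2 (hmono l k h))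

/-! ### Segments in the plane -/

section Segment

variable {v : Fin (1 + 1) → E 1}

theorem sum_fin_one_add_one (f : Fin (1 + 1) → ℝ) : ∑ i, f i = f 0 + f 1 :=
  Fin.sum_univ_two f

theorem gramMat_det_segment (v : Fin (1 + 1) → E 1) : (gramMat v).det = ‖v 1 - v 0‖ ^ 2 := by
  rw [Matrix.det_fin_one, gramMat, Matrix.of_apply, real_inner_self_eq_norm_sq]
  rfl

theorem segment_ne_zero (hv : AffineIndependent ℝ v) : v 1 - v 0 ≠ 0 :=
  sub_ne_zero.2 fun h => by simpa using hv.injective h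

theorem area_segment (v : Fin (1 + 1) → E 1) :
    area v = ‖v 1 - v 0‖ * ∫ _ in refSimplex 1, (1 : ℝ) := by
  rw [area_eq_sqrt_mul, gramMat_det_segment, Real.sqrt_sq (norm_nonneg _)]

theorem gradS_segment (v : Fin (1 + 1) → E 1) (f : Fin (1 + 1) → ℝ) :
    gradS v f = ((f 1 - f 0) / ‖v 1 - v 0‖ ^ 2) • (v 1 - v 0) := by
  have hinv : (gramMat v)⁻¹ 0 0 = (‖v 1 - v 0‖ ^ 2)⁻¹ := by
    rw [Matrix.inv_def, gramMat_det_segment, Matrix.adjugate_fin_one]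
    simp [Ring.inverse_eq_inv']
  simp only [gradS, Finset.univ_unique, Finset.sum_singleton, Fin.default_eq_zero]
  rw [hinv, div_eq_inv_mul]
  rfl

theorem gradSVec_segment (v u : Fin (1 + 1) → E 1) (i j : Fin (1 + 1)) :
    gradSVec v u i j = (u 1 - u 0) i * (v 1 - v 0) j / ‖v 1 - v 0‖ ^ 2 := by
  rw [gradSVec, Matrix.of_apply, gradS_segment]
  simp
  ring

theorem inner_eq_sum (x y : E 1) : inner ℝ x y = x 0 * y 0 + x 1 * y 1 := by
  simp [PiLp.inner_apply, sum_fin_one_add_one]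
  ring

theorem normSq_eq_sum (x : E 1) : ‖x‖ ^ 2 = x 0 * x 0 + x 1 * x 1 := by
  rw [← real_inner_self_eq_norm_sq, inner_eq_sum]

theorem divS_segment (v u : Fin (1 + 1) → E 1) :
    divS v u = inner ℝ (v 1 - v 0) (u 1 - u 0) / ‖v 1 - v 0‖ ^ 2 := by
  rw [divS, Matrix.trace, sum_fin_one_add_one, Matrix.diag_apply, Matrix.diag_apply,
    gradSVec_segment, gradSVec_segment, inner_eq_sum]
  ring

/-- The surface gradient of the identity is the tangential projection, so contracting with it takes
the trace of the tangential gradient. -/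
theorem frob_gradSVec_segment (hv : AffineIndependent ℝ v) (u : Fin (1 + 1) → E 1) :
    frob (gradSVec v v) (gradSVec v u) = divS v u := by
  have hne : ‖v 1 - v 0‖ ^ 2 ≠ 0 := pow_ne_zero 2 (norm_ne_zero_iff.2 (segment_ne_zero hv))
  have key := normSq_eq_sum (v 1 - v 0)
  rw [frob, divS_segment]
  simp only [sum_fin_one_add_one, gradSVec_segment]
  rw [inner_eq_sum]
  -- The squared length stays an atom while denominators are cleared; `key` then expands it in
  -- coordinates.
  generalize ‖v 1 - v 0‖ ^ 2 = N at *
  field_simp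
  rw [key]
  ring

theorem tangProj_segment (v : Fin (1 + 1) → E 1) (i j : Fin (1 + 1)) :
    tangProj v i j = (v 1 - v 0) i * (v 1 - v 0) j / ‖v 1 - v 0‖ ^ 2 := by
  have hr : range v = {v 1, v 0} := by
    ext x
    simp only [mem_range, mem_insert_iff, mem_singleton_iff]
    refine (Fin.exists_fin_two (p := fun i => v i = x)).trans ?_
    constructor
    · rintro (h | h) <;> simp [h]
    · rintro (h | h) <;> simp [h]
  have hs : vectorSpan ℝ (range v) = ℝ ∙ (v 1 - v 0) := by
    rw [hr, vectorSpan_pair]; rfl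
  rw [tangProj, Matrix.of_apply]
  simp only [hs]
  rw [Submodule.starProjection_singleton, EuclideanSpace.inner_single_right]
  simp
  ring

/-- The surface gradient on a segment has rank one, Δu ⊗ τ/|τ|² with τ the edge. Projecting both
sides onto τ leaves a multiple of τ ⊗ τ, whose coefficient is the divergence. The deviatoric part
therefore vanishes. -/
theorem symS_segment (hv : AffineIndependent ℝ v) (u : Fin (1 + 1) → E 1) :
    symS v u = divS v u • tangProj v := by
  have hne : ‖v 1 - v 0‖ ^ 2 ≠ 0 := pow_ne_zero 2 (norm_ne_zero_iff.2 (segment_ne_zero hv))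
  have key := normSq_eq_sum (v 1 - v 0)
  ext i j
  rw [symS, divS_segment]
  simp only [Matrix.smul_apply, Matrix.mul_apply, Matrix.add_apply, Matrix.transpose_apply,
    sum_fin_one_add_one, tangProj_segment, gradSVec_segment, smul_eq_mul]
  rw [inner_eq_sum]
  generalize ‖v 1 - v 0‖ ^ 2 = N at *
  field_simp
  rw [key]
  ring

theorem frob_tangProj_segment (hv : AffineIndependent ℝ v) :
    frob (tangProj v) (tangProj v) = 1 := by
  have hne : ‖v 1 - v 0‖ ^ 2 ≠ 0 := pow_ne_zero 2 (norm_ne_zero_iff.2 (segment_ne_zero hv))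
  have key := normSq_eq_sum (v 1 - v 0)
  simp only [frob, sum_fin_one_add_one, tangProj_segment]
  generalize ‖v 1 - v 0‖ ^ 2 = N at *
  field_simp
  rw [key]
  ring

theorem frob_symS_segment (hv : AffineIndependent ℝ v) (u : Fin (1 + 1) → E 1) :
    frob (symS v u) (symS v u) = divS v u * divS v u := by
  rw [symS_segment hv]
  have h := frob_tangProj_segment hv
  simp only [frob, Matrix.smul_apply, smul_eq_mul, sum_fin_one_add_one] at h ⊢
  linear_combination (divS v u * divS v u) * h

theorem devS_segment (hv : AffineIndependent ℝ v) (u : Fin (1 + 1) → E 1) : devS v u = 0 := by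
  rw [devS, symS_segment hv]
  simp

theorem hasDerivAt_area_segment {v : ℝ → Fin (1 + 1) → E 1} {v' : Fin (1 + 1) → E 1} {t : ℝ}
    (hv : ∀ i, HasDerivAt (fun s => v s i) (v' i) t) (ht : AffineIndependent ℝ (v t)) :
    HasDerivAt (fun s => area (v s)) (area (v t) * divS (v t) v') t := by
  simp only [area_segment, divS_segment]
  have hne := norm_ne_zero_iff.2 (segment_ne_zero ht)
  have h1 : HasDerivAt (fun s => ‖v s 1 - v s 0‖ ^ 2)
      (2 * inner ℝ (v t 1 - v t 0) (v' 1 - v' 0)) t := ((hv 1).fun_sub (hv 0)).norm_sq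
  have h2 := h1.sqrt (pow_ne_zero 2 hne)
  simp only [Real.sqrt_sq (norm_nonneg _)] at h2
  refine (h2.mul_const _).congr_deriv ?_
  field_simp

end Segment

/-! ### Polygonal curves -/

section Curve

variable {K J : ℕ} {σ : Fin J → Fin (1 + 1) → Fin K} {q : Fin K → E 1}

theorem inner_gradS_segment {v : Fin (1 + 1) → E 1} (hv : AffineIndependent ℝ v)
    (f g : Fin (1 + 1) → ℝ) : inner ℝ (gradS v f) (gradS v g) =
      (f 1 - f 0) * (g 1 - g 0) / ‖v 1 - v 0‖ ^ 2 := by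
  have hne := norm_ne_zero_iff.2 (segment_ne_zero hv)
  rw [gradS_segment, gradS_segment, real_inner_smul_left, real_inner_smul_right,
    real_inner_self_eq_norm_sq]
  field_simp

/-- Both gradients are multiples of the same edge vector, so their product has the sign of the
product of the two vertex differences. -/
theorem diffForm_curve_nonneg (hq : ∀ j, AffineIndependent ℝ (loc σ q j)) {ψ g : Fin K → ℝ}
    (h : ∀ k l, 0 ≤ (ψ k - ψ l) * (g k - g l)) : 0 ≤ diffForm σ q ψ g := by
  rw [diffForm_eq_sum_area]
  refine Finset.sum_nonneg fun j _ => mul_nonneg (area_pos (hq j)).le ?_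
  rw [inner_gradS_segment (hq j)]
  exact div_nonneg (h _ _) (sq_nonneg _)

/-- The two hat functions of a segment have opposite slopes. The angle condition is automatic for
curves, which makes the persistence of positivity available for the energy estimate. -/
theorem nonObtuse_curve {T : ℝ} {Ω : Set (E 1)} {S : Fields 1 K Ω}
    (h : ∀ t ∈ Icc 0 T, IsPolyhedral σ (S.q t)) : NonObtuse T σ S := by
  intro t ht j i k hik
  have hq := (h t ht).nondegenerate j
  rw [elemIntegral_const, inner_gradS_segment hq]
  refine mul_nonpos_of_nonneg_of_nonpos (area_pos hq).le
    (div_nonpos_of_nonpos_of_nonneg ?_ (sq_nonneg _))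
  have h0 : ∀ l m, 0 ≤ (Pi.single l (1 : ℝ) : Fin K → ℝ) m := fun l m => by
    by_cases hl : m = l
    · subst hl; simp
    · simp [hl]
  have hz : ∀ m, (Pi.single i (1 : ℝ) : Fin K → ℝ) m * (Pi.single k (1 : ℝ) : Fin K → ℝ) m = 0 := by
    intro m
    by_cases hm : m = i
    · subst hm; simp [hik]
    · simp [hm]
  simp only [loc]
  nlinarith [hz (σ j 0), hz (σ j 1), mul_nonneg (h0 i (σ j 1)) (h0 k (σ j 0)),
    mul_nonneg (h0 i (σ j 0)) (h0 k (σ j 1))]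

/-- Transport theorem for the lumped integral. -/
theorem hasDerivAt_lump_curve {q : ℝ → Fin K → E 1} {q' : Fin K → E 1}
    {g : ℝ → Fin J → Fin (1 + 1) → ℝ} {g' : Fin J → Fin (1 + 1) → ℝ} {t : ℝ}
    (hnd : ∀ j, AffineIndependent ℝ (loc σ (q t) j))
    (hq : ∀ k, HasDerivAt (fun s => q s k) (q' k) t)
    (hg : ∀ j i, HasDerivAt (fun s => g s j i) (g' j i) t) :
    HasDerivAt (fun s => lump σ (q s) (g s))
      (lump σ (q t) fun j i => g' j i + g t j i * divS (loc σ (q t) j) (loc σ q' j)) t := by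
  have h := (HasDerivAt.fun_sum (u := Finset.univ) fun j _ =>
    (hasDerivAt_area_segment (v := fun s => loc σ (q s) j) (v' := loc σ q' j)
      (fun i => hq _) (hnd j)).fun_mul
    (HasDerivAt.fun_sum (u := Finset.univ) fun i _ => hg j i)).const_mul
      (1 / (((1 : ℕ) : ℝ) + 1))
  refine h.congr_deriv ?_
  unfold lump
  refine congrArg _ (Finset.sum_congr rfl fun j _ => ?_)
  rw [Finset.sum_add_distrib, ← Finset.sum_mul]
  ring

theorem curvature_identity (hnd : ∀ j, AffineIndependent ℝ (loc σ q j)) {κ u : Fin K → E 1}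
    {g : Fin K → ℝ}
    (hκ : ∀ η : Fin K → E 1, (lump σ q fun j i => inner ℝ (κ (σ j i)) (η (σ j i))) +
      (surfInt σ q fun j _ => frob (gradSVec (loc σ q j) (loc σ q j))
        (gradSVec (loc σ q j) (loc σ η j))) = 0) :
    (lump σ q fun j i => inner ℝ (g (σ j i) • κ (σ j i) + gradS (loc σ q j) (loc σ g j))
      (u (σ j i))) = -lump σ q fun j i => g (σ j i) * divS (loc σ q j) (loc σ u j) := by
  have h := hκ fun k => g k • u k
  simp only [surfInt, elemIntegral_const] at h
  have e1 : (lump σ q fun j i => inner ℝ (g (σ j i) • κ (σ j i) + gradS (loc σ q j) (loc σ g j))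
      (u (σ j i))) = (lump σ q fun j i => inner ℝ (κ (σ j i)) (g (σ j i) • u (σ j i))) +
      lump σ q fun j i => inner ℝ (gradS (loc σ q j) (loc σ g j)) (u (σ j i)) := by
    simp only [lump, inner_add_left, real_inner_smul_left, real_inner_smul_right,
      Finset.sum_add_distrib, mul_add]
  -- A product rule for lumped averages on a segment: g₁u₁ - g₀u₀ = (g₁ - g₀)(u₀ + u₁)/2 + (g₀ +
  -- g₁)(u₁ - u₀)/2.
  have e2 : (∑ j, area (loc σ q j) * frob (gradSVec (loc σ q j) (loc σ q j))
        (gradSVec (loc σ q j) (loc σ (fun k => g k • u k) j))) =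
      (lump σ q fun j i => inner ℝ (gradS (loc σ q j) (loc σ g j)) (u (σ j i))) +
      lump σ q fun j i => g (σ j i) * divS (loc σ q j) (loc σ u j) := by
    simp only [lump, Finset.mul_sum (s := (Finset.univ : Finset (Fin J)))]
    rw [← Finset.sum_add_distrib]
    refine Finset.sum_congr rfl fun j _ => ?_
    rw [frob_gradSVec_segment (hnd j)]
    simp only [sum_fin_one_add_one, divS_segment, gradS_segment, real_inner_smul_left,
      inner_sub_right, Nat.cast_one]
    simp only [loc, real_inner_smul_right]
    ring
  rw [e1]
  linarith

theorem surface_dissipation (hnd : ∀ j, AffineIndependent ℝ (loc σ q j)) (u : Fin K → E 1)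
    (m l : Fin K → ℝ) :
    2 * (lump σ q fun j i => m (σ j i) *
        frob (devS (loc σ q j) (loc σ u j)) (devS (loc σ q j) (loc σ u j))) +
      (lump σ q fun j i => (l (σ j i) + 2 / ((1 : ℕ) : ℝ) * m (σ j i)) *
        divS (loc σ q j) (loc σ u j) * divS (loc σ q j) (loc σ u j)) =
    2 * (lump σ q fun j i => m (σ j i) *
        frob (symS (loc σ q j) (loc σ u j)) (symS (loc σ q j) (loc σ u j))) +
      lump σ q fun j i => l (σ j i) *
        divS (loc σ q j) (loc σ u j) * divS (loc σ q j) (loc σ u j) := by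
  simp only [lump, Finset.mul_sum (s := (Finset.univ : Finset (Fin J))),
    ← Finset.sum_add_distrib]
  refine Finset.sum_congr rfl fun j _ => ?_
  rw [devS_segment (hnd j), frob_symS_segment (hnd j)]
  simp only [sum_fin_one_add_one, frob, Matrix.zero_apply, Nat.cast_one]
  ring

end Curve

/-! ### Energy balance in the plane -/

section Energy

variable {n N K J : ℕ} {Ω : Set (E n)} {mesh : Fin N → BulkSimplex n} {ph : Phys n}
  {S : Fields n K Ω}

theorem phaseCoeff_nonneg (mesh : Fin N → BulkSimplex n) (Ωm Ωp : Set (E n)) {am ap : ℝ}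
    (hm : 0 ≤ am) (hp : 0 ≤ ap) (x : E n) : 0 ≤ phaseCoeff mesh Ωm Ωp am ap x := by
  refine Finset.sum_nonneg fun e _ => indicator_nonneg (fun _ _ => ?_) x
  split_ifs
  · exact hm
  · exact hp
  · positivity

theorem integral_norm_sqrt_rhoh (t : ℝ) :
    (∫ x in Ω, ‖Real.sqrt (rhoh ph mesh S t x) • ext (S.U t) x‖ ^ 2) =
      massForm ph mesh S S.U S.U t := by
  unfold massForm
  congr 1
  ext x
  have h : 0 ≤ rhoh ph mesh S t x := phaseCoeff_nonneg _ _ _ ph.rhoM_pos.le ph.rhoP_pos.le x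
  rw [norm_smul, mul_pow, Real.norm_eq_abs, sq_abs, Real.sq_sqrt h, real_inner_self_eq_norm_sq]

theorem integral_frob_sqrt_muh (t : ℝ) :
    (∫ x in Ω, frob (Real.sqrt (muh ph mesh S t x) • bulkSym (ext (S.U t)) x)
      (Real.sqrt (muh ph mesh S t x) • bulkSym (ext (S.U t)) x)) =
      viscForm ph mesh S S.U S.U t := by
  unfold viscForm
  congr 1
  ext x
  have h : 0 ≤ muh ph mesh S t x := phaseCoeff_nonneg _ _ _ ph.muM_pos.le ph.muP_pos.le x
  simp only [frob, Finset.mul_sum, Matrix.smul_apply, smul_eq_mul]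
  refine Finset.sum_congr rfl fun i _ => Finset.sum_congr rfl fun j _ => ?_
  rw [mul_mul_mul_comm, Real.mul_self_sqrt h]

theorem massForm_comm (u ξ : ℝ → CBar Ω) (t : ℝ) :
    massForm ph mesh S u ξ t = massForm ph mesh S ξ u t := by
  simp only [massForm, real_inner_comm]

theorem convForm_self (u : ℝ → CBar Ω) (t : ℝ) : convForm ph mesh S u u t = 0 := by
  simp [convForm]

variable {T : ℝ} {Uh : Submodule ℝ (CBar Ω)} {Ph : ℝ → Submodule ℝ (Pressure Ω)}
  {f₁ f₂ : ℝ → CBar Ω} {σ : Fin J → Fin (n + 1) → Fin K}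

theorem lump_inner_single (q : Fin K → E n) (z : Fin K → E n) (k : Fin K) (x : E n) :
    (lump σ q fun j i => inner ℝ (z (σ j i)) ((Pi.single k x : Fin K → E n) (σ j i))) =
      nodeMass σ q k * inner ℝ (z k) x := by
  rw [← lump_mul_single q (fun l => inner ℝ (z l) x)]
  congr 1
  ext j i
  by_cases h : σ j i = k
  · rw [h]; simp
  · simp [h]

/-- At almost every time the vertices move with the fluid velocity. -/
theorem IsSolution.vertex_velocity (hS : IsSolution T mesh Uh Ph ph f₁ f₂ σ S) :
    ∀ᵐ t ∂(volume.restrict (Ioo 0 T)), ∀ k,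
      HasDerivAt (fun s => S.q s k) (trace S S.U t k) t := by
  filter_upwards [hS.velocity, ae_restrict_mem measurableSet_Ioo] with t ht htm k
  have htc := Ioo_subset_Icc_self htm
  -- Testing at one vertex with the velocity defect itself yields its squared norm times a positive
  -- mass.
  have h := ht (Pi.single k (dt T S.q t k - trace S S.U t k))
  rw [lump_inner_single, lump_inner_single] at h
  have h1 := mul_left_cancel₀ (nodeMass_pos (hS.polyhedral t htc) k).ne' h
  rw [← sub_eq_zero, ← inner_sub_left, inner_self_eq_zero, sub_eq_zero] at h1
  rw [← h1]
  exact ((hS.q_diff k t htc).hasDerivWithinAt).hasDerivAt (Icc_mem_nhds htm.1 htm.2)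

/-- Kinetic energy of the surface mass. -/
theorem IsSolution.surfMass_deriv (hS : IsSolution T mesh Uh Ph ph f₁ f₂ σ S) :
    ∀ᵐ t ∂(volume.restrict (Ioo 0 T)), HasDerivAt (surfMassForm σ S S.U S.U)
      (2 * lump σ (S.q t) fun j i => S.rhoG t (σ j i) *
        inner ℝ (trace S S.U t (σ j i)) (dt T (trace S S.U) t (σ j i))) t := by
  -- Mass transport is tested with the squared speed at the vertices, which is C¹ in time because
  -- the velocity trace is.
  have hζ : IsWT T fun t k => (inner ℝ (trace S S.U t k) (trace S S.U t k) : ℝ) :=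
    fun k => (hS.U_trace k).inner ℝ (hS.U_trace k)
  filter_upwards [hS.density _ hζ, ae_restrict_mem measurableSet_Ioo] with t ht htm
  have htc := Ioo_subset_Icc_self htm
  refine ht.congr_deriv ?_
  have hd : ∀ k, dt T (fun t k => (inner ℝ (trace S S.U t k) (trace S S.U t k) : ℝ)) t k =
      2 * inner ℝ (trace S S.U t k) (dt T (trace S S.U) t k) := by
    intro k
    have h1 := ((hS.U_trace k).differentiableOn one_ne_zero t htc).hasDerivWithinAt
    have h2 := (h1.inner ℝ h1).derivWithin (uniqueDiffOn_Icc (htm.1.trans htm.2) t htc)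
    refine h2.trans ?_
    rw [real_inner_comm (trace S S.U t k)]
    simp only [dt]
    ring
  simp only [hd, lump, Finset.mul_sum]
  refine Finset.sum_congr rfl fun j _ => Finset.sum_congr rfl fun i _ => ?_
  ring

/-- At almost every time each vertex value is positive or vanishes in a neighbourhood. -/
theorem IsSolution.Psi_pos_or_locally_zero (hS : IsSolution T mesh Uh Ph ph f₁ f₂ σ S)
    (h : ph.DG = 0 ∨ NonObtuse T σ S) (hn : ∀ t ∈ Icc 0 T, PsiNonneg σ S t) :
    ∀ᵐ t ∂(volume.restrict (Ioo 0 T)), ∀ k, 0 < S.Psi t k ∨ ∀ᶠ s in 𝓝 t, S.Psi s k = 0 := by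
  rw [ae_all_iff]
  intro k
  set A : Set ℝ := {t | t ∈ Ioo 0 T ∧ S.Psi t k = 0 ∧ ¬ ∀ᶠ s in 𝓝 t, S.Psi s k = 0} with hA
  -- A zero at a later time t' forces zeros at all earlier times, hence in a neighbourhood of t. So
  -- A has at most one element.
  have hlt : ∀ t ∈ A, ∀ t' ∈ A, ¬ t < t' := fun t ht t' ht' htt => ht.2.2 (by
    filter_upwards [Ioo_mem_nhds ht.1.1 htt] with s hs
    exact hS.Psi_eq_zero_of_le h hn hs.1.le hs.2.le ht'.1.2.le ht'.2.1)
  have hsub : A.Subsingleton := fun t ht t' ht' =>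
    le_antisymm (not_lt.1 (hlt t' ht' t ht)) (not_lt.1 (hlt t ht t' ht'))
  have hnull : ∀ᵐ t ∂(volume.restrict (Ioo 0 T)), t ∉ A :=
    ae_restrict_of_ae (measure_eq_zero_iff_ae_notMem.1 (hsub.countable.measure_zero volume))
  filter_upwards [hnull, ae_restrict_mem measurableSet_Ioo] with t ht htm
  have htc := Ioo_subset_Icc_self htm
  rcases ((hS.psiNonneg_iff htc).1 (hn t htc) k).lt_or_eq with h0 | h0
  · exact Or.inl h0
  · by_contra hcon
    exact ht ⟨htm, h0.symm, fun hc => hcon (Or.inr hc)⟩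

end Energy

/-! ### Surface free energy and the full energy inequality for curves -/

section Plane

variable {N K J : ℕ} {Ω : Set (E 1)} {mesh : Fin N → BulkSimplex 1} {ph : Phys 1}
  {S : Fields 1 K Ω} {T : ℝ} {Uh : Submodule ℝ (CBar Ω)} {Ph : ℝ → Submodule ℝ (Pressure Ω)}
  {f₁ f₂ : ℝ → CBar Ω} {σ : Fin J → Fin (1 + 1) → Fin K}

/-- Evolution of the surface free energy. -/
theorem IsSolution.surfaceEnergy_deriv (hS : IsSolution T mesh Uh Ph ph f₁ f₂ σ S)
    (hn : ∀ t ∈ Icc 0 T, PsiNonneg σ S t) (hb : ∀ t ∈ Icc 0 T, PsiBelow ph σ S t) :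
    ∀ᵐ t ∂(volume.restrict (Ioo 0 T)), ∃ c : ℝ,
      HasDerivAt (fun s => lump σ (S.q s) fun j i => ph.F (S.Psi s (σ j i))) c t ∧
      c ≤ lump σ (S.q t) fun j i => ph.γ (S.Psi t (σ j i)) *
        divS (loc σ (S.q t) j) (loc σ (trace S S.U t) j) := by
  filter_upwards [hS.vertex_velocity, hS.Psi_pos_or_locally_zero
    (Or.inr (nonObtuse_curve hS.polyhedral)) hn, ae_restrict_mem measurableSet_Ioo]
    with t hq hz htm
  have htc := Ioo_subset_Icc_self htm
  have hnhds : Icc 0 T ∈ 𝓝 t := Icc_mem_nhds htm.1 htm.2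
  have hnd := (hS.polyhedral t htc).nondegenerate
  obtain ⟨g, hg, hmono⟩ := ph.exists_slopes (ψ := S.Psi t)
    fun k => hS.psiBelow_vertex htc (hb t htc) k
  have hΨ : ∀ k, HasDerivAt (fun s => S.Psi s k) (deriv (fun s => S.Psi s k) t) t := fun k =>
    ((hS.Psi_diff k t htc).differentiableAt hnhds).hasDerivAt
  set Ψ' : Fin K → ℝ := fun k => deriv (fun s => S.Psi s k) t
  have hF : ∀ k, HasDerivAt (fun s => ph.F (S.Psi s k)) (Ψ' k * g k) t := by
    intro k
    rcases hz k with h0 | h0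
    · have hFd := (ph.F_diff _ h0 (hS.psiBelow_vertex htc (hb t htc) k)).hasDerivAt
      rw [hg k h0, mul_comm]
      exact HasDerivAt.comp t hFd (hΨ k)
    · have h1 : Ψ' k = 0 := (hΨ k).unique
        ((hasDerivAt_const t (0 : ℝ)).congr_of_eventuallyEq h0)
      rw [h1, zero_mul]
      refine (hasDerivAt_const t (ph.F 0)).congr_of_eventuallyEq ?_
      filter_upwards [h0] with s hs
      rw [hs]
  -- Where the concentration vanishes the product with g drops out whatever g is, and the identity
  -- reduces to F(0) = γ(0).
  have hFγ : ∀ k, ph.F (S.Psi t k) = S.Psi t k * g k + ph.γ (S.Psi t k) := by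
    intro k
    rcases hz k with h0 | h0
    · rw [hg k h0, ph.F_eq _ h0 (hS.psiBelow_vertex htc (hb t htc) k)]
      ring
    · rw [h0.self_of_nhds, ph.F_zero]
      ring
  have hEnergy := hasDerivAt_lump_curve (σ := σ) (q := S.q)
    (g := fun s j i => ph.F (S.Psi s (σ j i))) hnd hq fun j i => hF _
  have hMass := hasDerivAt_lump_curve (σ := σ) (q := S.q)
    (g := fun s j i => S.Psi s (σ j i) * g (σ j i)) hnd hq fun j i => (hΨ _).mul_const _
  -- The test values g are F'(Ψ) frozen at the present time t, so they change with t. The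
  -- almost-everywhere form, whose null set depends on the test function, would not suffice here.
  have hu := hMass.unique ((hS.surfactant_everywhere g t htc).hasDerivAt hnhds)
  refine ⟨_, hEnergy, ?_⟩
  have hsplit : (lump σ (S.q t) fun j i => Ψ' (σ j i) * g (σ j i) + ph.F (S.Psi t (σ j i)) *
        divS (loc σ (S.q t) j) (loc σ (trace S S.U t) j)) =
      (lump σ (S.q t) fun j i => Ψ' (σ j i) * g (σ j i) + S.Psi t (σ j i) * g (σ j i) *
        divS (loc σ (S.q t) j) (loc σ (trace S S.U t) j)) +
      lump σ (S.q t) fun j i => ph.γ (S.Psi t (σ j i)) *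
        divS (loc σ (S.q t) j) (loc σ (trace S S.U t) j) := by
    simp only [lump, hFγ, ← mul_add, ← Finset.sum_add_distrib]
    refine congrArg _ (Finset.sum_congr rfl fun j _ => congrArg _
      (Finset.sum_congr rfl fun i _ => ?_))
    ring
  rw [hsplit, hu]
  have := mul_nonneg ph.DG_nonneg (diffForm_curve_nonneg hnd hmono)
  linarith

theorem IsSolution.energy_inequality (hS : IsSolution T mesh Uh Ph ph f₁ f₂ σ S)
    (hn : ∀ t ∈ Icc 0 T, PsiNonneg σ S t) (hb : ∀ t ∈ Icc 0 T, PsiBelow ph σ S t) :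
    ∀ᵐ t ∂(volume.restrict (Ioo 0 T)), ∃ e : ℝ, HasDerivAt (energy ph mesh σ S) e t ∧
      e + dissipation ph mesh σ S t ≤ forceForm ph mesh S f₁ f₂ S.U t := by
  filter_upwards [hS.momentum S.U S.Ut hS.U_mem, hS.surfMass_deriv, hS.surfaceEnergy_deriv hn hb,
    hS.incompressible, hS.P_mem, hS.curvature, ae_restrict_mem measurableSet_Ioo]
    with t ⟨a, b, ha, hb', hmom⟩ hsm ⟨c, hc, hcle⟩ hinc hP hκ htm
  have hnd := (hS.polyhedral t (Ioo_subset_Icc_self htm)).nondegenerate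
  -- The derivative b of ⟨ρ_Γ U, U⟩ʰ is twice the material derivative term on the right of the
  -- momentum equation; subtracting that term leaves b/2, the surface kinetic energy rate.
  have hbe := hb'.unique hsm
  refine ⟨1 / 2 * a + 1 / 2 * b + c, ?_, ?_⟩
  · have he : energy ph mesh σ S = fun s => 1 / 2 * massForm ph mesh S S.U S.U s +
        1 / 2 * surfMassForm σ S S.U S.U s +
        lump σ (S.q s) fun j i => ph.F (S.Psi s (σ j i)) := by
      ext s
      rw [energy, integral_norm_sqrt_rhoh]
    rw [he]
    exact ((ha.const_mul _).fun_add (hb'.const_mul _)).fun_add hc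
  · have hpr : (∫ x in Ω, S.P t x * bulkDiv (ext (S.U t)) x) = 0 := by
      rw [← hinc _ hP]
      simp only [mul_comm]
    have hcurv := curvature_identity hnd (u := trace S S.U t) (g := fun k => ph.γ (S.Psi t k)) hκ
    have hdiss := surface_dissipation hnd (trace S S.U t) (fun k => ph.muG (S.Psi t k))
      fun k => ph.lamG (S.Psi t k)
    -- Symmetry cancels the two terms with U_t, leaving half the derivative of (ρU, U). The
    -- remaining surface tension term ⟨γ(Ψ), ∇·U⟩ʰ is the upper bound for the free energy rate in
    -- `hcle`.
    rw [massForm_comm S.Ut, convForm_self, hpr, hcurv] at hmom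
    rw [dissipation, integral_frob_sqrt_muh]
    linarith

end Plane

end TwoPhase

theorem theorem3p4
    (n : ℕ) (hn : n = 1 ∨ n = 2) (T : ℝ) (hT : 0 < T)
    (Ω bd1 bd2 : Set (TwoPhase.E n)) (hΩ : IsOpen Ω) (hΩc : IsConnected Ω)
    (hbd : bd1 ∪ bd2 = frontier Ω) (hbd' : Disjoint bd1 bd2)
    (N K J : ℕ) (mesh : Fin N → TwoPhase.BulkSimplex n) (hmesh : TwoPhase.IsTriangulation Ω mesh)
    (Uh : Submodule ℝ (TwoPhase.CBar Ω)) (hUh : TwoPhase.IsVelocitySpace Ω bd1 bd2 mesh Uh)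
    (Ph : ℝ → Submodule ℝ (TwoPhase.Pressure Ω))
    (ph : TwoPhase.Phys n) (f₁ f₂ : ℝ → TwoPhase.CBar Ω)
    (hf₁ : MemLp f₁ 2 (volume.restrict (Ioo 0 T))) (hf₂ : MemLp f₂ 2 (volume.restrict (Ioo 0 T)))
    (σ : Fin J → Fin (n + 1) → Fin K) (S : TwoPhase.Fields n K Ω)
    (hS : TwoPhase.IsSolution T mesh Uh Ph ph f₁ f₂ σ S) :
    (∀ t ∈ Icc 0 T, HasDerivWithinAt (TwoPhase.totalSurfactant σ S) 0 (Icc 0 T) t) ∧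
    ((ph.DG = 0 ∨ (TwoPhase.NonObtuse T σ S ∧ TwoPhase.DivBounded T σ S)) →
      TwoPhase.PsiNonneg σ S 0 → ∀ t ∈ Ioc 0 T, TwoPhase.PsiNonneg σ S t) ∧
    (n = 1 → (∀ t ∈ Icc 0 T, TwoPhase.PsiNonneg σ S t) →
      (∀ t ∈ Icc 0 T, TwoPhase.PsiBelow ph σ S t) →
      ∀ᵐ t ∂(volume.restrict (Ioo 0 T)), ∃ e : ℝ,
        HasDerivAt (TwoPhase.energy ph mesh σ S) e t ∧
        e + TwoPhase.dissipation ph mesh σ S t ≤ TwoPhase.forceForm ph mesh S f₁ f₂ S.U t) := by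
  refine ⟨hS.totalSurfactant_conserved, fun h h0 => hS.psiNonneg (h.imp_right And.left) hT h0, ?_⟩
  rintro rfl hn hb
  exact hS.energy_inequality hn hb
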